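/- Let $V$ be a finite-dimensional real vector space. For $A\in\operatorname{End}(V)$ let $\psi_A$ be the projective flow of $A$, that is, the continuous flow $\psi_A(t,\mathbb{P}x)=\mathbb{P}(e^{At}x)$ ($t\in\mathbb{R}$, $x\in V\setminus\{0\}$) on the projective space $\mathbb{P}(V)$ (with the quotient topology of $V\setminus\{0\}$). Two flows $\psi_A$, $\psi_B$ are topologically conjugate if there is a homeomorphism $h$ of $\mathbb{P}(V)$ with $h(\psi_A(t,p))=\psi_B(t,h(p))$ for all $t\in\mathbb{R}$, $p\in\mathbb{P}(V)$. For $A$ with all (complex) eigenvalues on the imaginary axis, let $s_{\max}(A)$ be the largest dimension of a complex Jordan subspace of $A$, i.e. of a subspace of $\mathbb{C}\otimes V$ with a basis in which $A$ acts as a single Jordan block. Decompose $V$ as a direct sum of real Jordan subspaces of $A$: each of them is of some size $s\geq 1$, meaning that it has dimension $s$ and $A$ acts on it as one Jordan block with eigenvalue $0$, or that it has dimension $2s$ and $A$ acts on it as one real Jordan block for a pair $\pm i\omega$ with $\omega>0$. Let $J_s$ be the sum of the subspaces of size $s$, and let $d_s(A)$ be the dimension of the sum of the real eigenspaces inside $J_s$,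 i.e. of $\sum_{\omega}\big(V\cap(E(i\omega)\oplus E(-i\omega))\big)\cap J_s$ (with $V\cap E(0)$ in place of $V\cap(E(i\omega)\oplus E(-i\omega))$ for $\omega=0$), where $E(\cdot)$ denotes complex eigenspaces of $A$. Such decompositions exist, and $d_s(A)$ does not depend on the choice of one. Let $A,B\in\operatorname{End}(V)$ have all their eigenvalues on the imaginary axis, and suppose that $\psi_A$ and $\psi_B$ are topologically conjugate. Then $s_{\max}(A)=s_{\max}(B)$, and $d_s(A)=d_s(B)$ for all $s=1,\dots,s_{\max}(A)$. In this sense the Jordan structures of $A$ and $B$ coincide. -/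

import Mathlib

open scoped LinearAlgebra.Projectivization TensorProduct

noncomputable section

namespace ProjFlow

/-! ### Topological conjugacy of flows -/

/-- Two continuous flows are topologically conjugate if some homeomorphism intertwines them. -/
def TopConjugate {X Y : Type*} [TopologicalSpace X] [TopologicalSpace Y]
    (φ : Flow ℝ X) (ψ : Flow ℝ Y) : Prop :=
  ∃ h : X ≃ₜ Y, ∀ (t : ℝ) (x : X), h (φ t x) = ψ t (h x)

/-! ### Projective space with its quotient topology, and the projective flow -/

section Flow

variable {V : Type*} [NormedAddCommGroup V] [NormedSpace ℝ V]

/-- The real projective space of `V` carries the quotient topology of `V \ {0}`. -/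
instance instTopologicalSpaceProj : TopologicalSpace (ℙ ℝ V) :=
  TopologicalSpace.coinduced (Projectivization.mk' ℝ) inferInstance

theorem isQuotientMap_mk' :
    Topology.IsQuotientMap (Projectivization.mk' ℝ : {v : V // v ≠ 0} → ℙ ℝ V) :=
  ⟨⟨rfl⟩, Quotient.mk''_surjective⟩

theorem isOpenQuotientMap_mk' :
    IsOpenQuotientMap (Projectivization.mk' ℝ : {v : V // v ≠ 0} → ℙ ℝ V) := by
  refine ⟨isQuotientMap_mk'.surjective, isQuotientMap_mk'.continuous, fun U hU => ?_⟩
  rw [← isQuotientMap_mk'.isOpen_preimage]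
  have key : (Projectivization.mk' ℝ : {v : V // v ≠ 0} → ℙ ℝ V) ⁻¹'
      (Projectivization.mk' ℝ '' U) =
      ⋃ a : ℝˣ, (fun v : {v : V // v ≠ 0} =>
        (⟨a • (v : V), (smul_ne_zero_iff_ne a).2 v.2⟩ : {v : V // v ≠ 0})) ⁻¹' U := by
    ext v
    simp only [Set.mem_preimage, Set.mem_image, Set.mem_iUnion]
    constructor
    · rintro ⟨u, hu, huv⟩
      obtain ⟨a, ha⟩ := (Projectivization.mk_eq_mk_iff ℝ u.1 v.1 u.2 v.2).1 huv
      refine ⟨a, ?_⟩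
      have : (⟨a • (v : V), (smul_ne_zero_iff_ne a).2 v.2⟩ : {v : V // v ≠ 0}) = u :=
        Subtype.ext ha
      rwa [this]
    · rintro ⟨a, ha⟩
      exact ⟨_, ha, (Projectivization.mk_eq_mk_iff ℝ _ v.1 _ v.2).2 ⟨a, rfl⟩⟩
  rw [key]
  refine isOpen_iUnion fun a => hU.preimage ?_
  exact Continuous.subtype_mk (continuous_subtype_val.const_smul a) _

variable [FiniteDimensional ℝ V]

/-- The operator `exp (t A)` on `V`. -/
def expMap (A : Module.End ℝ V) (t : ℝ) : V →L[ℝ] V :=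
  NormedSpace.exp (t • LinearMap.toContinuousLinearMap A)

theorem expMap_zero (A : Module.End ℝ V) : expMap A 0 = 1 := by
  simp [expMap]

theorem expMap_add (A : Module.End ℝ V) (s t : ℝ) :
    expMap A (s + t) = expMap A s * expMap A t := by
  have := FiniteDimensional.complete ℝ V
  let : NormedAlgebra ℚ (V →L[ℝ] V) := NormedAlgebra.restrictScalars ℚ ℝ (V →L[ℝ] V)
  unfold expMap
  rw [add_smul]
  exact NormedSpace.exp_add_of_commute (((Commute.refl _).smul_left s).smul_right t)

theorem expMap_injective (A : Module.End ℝ V) (t : ℝ) :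
    Function.Injective (expMap A t : V →ₗ[ℝ] V) := by
  refine Function.LeftInverse.injective (g := expMap A (-t)) fun x => ?_
  have h : expMap A (-t) * expMap A t = 1 := by
    rw [← expMap_add, neg_add_cancel, expMap_zero]
  exact congrArg (fun f : V →L[ℝ] V => f x) h

theorem continuous_expMap_apply (A : Module.End ℝ V) :
    Continuous fun p : ℝ × V => expMap A p.1 p.2 := by
  have := FiniteDimensional.complete ℝ V
  let : NormedAlgebra ℚ (V →L[ℝ] V) := NormedAlgebra.restrictScalars ℚ ℝ (V →L[ℝ] V)
  have h : Continuous (expMap A) :=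
    NormedSpace.exp_continuous.comp (continuous_id.smul continuous_const)
  exact (h.comp continuous_fst).clm_apply continuous_snd

/-- The projective flow of `A`: it sends `(t, ℙ x)` to `ℙ (exp (t A) x)`. -/
def projFlow (A : Module.End ℝ V) : Flow ℝ (ℙ ℝ V) where
  toFun t := Projectivization.map (expMap A t : V →ₗ[ℝ] V) (expMap_injective A t)
  cont' := by
    have hq : IsOpenQuotientMap (Prod.map (id : ℝ → ℝ)
        (Projectivization.mk' ℝ : {v : V // v ≠ 0} → ℙ ℝ V)) :=
      IsOpenQuotientMap.id.prodMap isOpenQuotientMap_mk'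
    refine hq.isQuotientMap.continuous_iff.2 ?_
    have hc : Continuous fun p : ℝ × {v : V // v ≠ 0} =>
        (⟨expMap A p.1 p.2, fun h0 => p.2.2 (expMap_injective A p.1
          (by simpa using h0))⟩ : {v : V // v ≠ 0}) :=
      ((continuous_expMap_apply A).comp
        (continuous_fst.prodMk (continuous_subtype_val.comp continuous_snd))).subtype_mk _
    exact isQuotientMap_mk'.continuous.comp hc
  map_add' s t x := by
    induction x using Projectivization.ind with
    | h v hv => simp [Projectivization.map_mk, expMap_add]
  map_zero' x := by
    induction x using Projectivization.ind with
    | h v hv => simp [Projectivization.map_mk, expMap_zero]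

theorem projFlow_mk (A : Module.End ℝ V) (t : ℝ) (x : V) (hx : x ≠ 0) :
    projFlow A t (Projectivization.mk ℝ x hx) = Projectivization.mk ℝ (expMap A t x)
      (fun h0 => hx (expMap_injective A t (by simpa using h0))) :=
  rfl

end Flow

/-! ### Jordan structure -/

section Jordan

/-- The predecessor of the `j`-th vector in a chain, which is `0` for the first one. -/
def chainPred {M : Type*} [Zero M] {n : ℕ} (e : Fin n → M) (j : Fin n) : M :=
  if j.val = 0 then 0 else e ⟨j.val - 1, by omega⟩

variable {V : Type*} [AddCommGroup V] [Module ℝ V]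

/-- The complexification of `A`, acting on `ℂ ⊗ V`. -/
def complexify (A : Module.End ℝ V) : Module.End ℂ (ℂ ⊗[ℝ] V) :=
  LinearMap.baseChange ℂ A

/-- All (complex) eigenvalues of `A` lie on the imaginary axis. -/
def EigenvaluesImaginary (A : Module.End ℝ V) : Prop :=
  ∀ z : ℂ, (complexify A).HasEigenvalue z → z.re = 0

/-- `W` is a complex Jordan subspace of `A` of dimension `s` for the eigenvalue `z`: it has a basis
`e` in which the complexification of `A` is a single Jordan block. -/
def IsComplexJordanSubspace (A : Module.End ℝ V) (z : ℂ) (s : ℕ)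
    (W : Submodule ℂ (ℂ ⊗[ℝ] V)) : Prop :=
  ∃ e : Fin s → ℂ ⊗[ℝ] V, LinearIndependent ℂ e ∧ Submodule.span ℂ (Set.range e) = W ∧
    ∀ j, complexify A (e j) = z • e j + chainPred e j

/-- The largest dimension of a complex Jordan subspace of `A` (for finite-dimensional `V` the
supremum is over a set bounded by `dim V`). -/
def sMax (A : Module.End ℝ V) : ℕ :=
  sSup {s : ℕ | ∃ (z : ℂ) (W : Submodule ℂ (ℂ ⊗[ℝ] V)), IsComplexJordanSubspace A z s W}

/-- The real eigenspace `V ∩ (E(iω) + E(-iω))`, where `E` denotes complex eigenspaces. -/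
def realEigenspace (A : Module.End ℝ V) (ω : ℝ) : Submodule ℝ V :=
  (((complexify A).eigenspace (Complex.I * ω) ⊔
      (complexify A).eigenspace (-(Complex.I * ω))).restrictScalars ℝ).comap
    (TensorProduct.mk ℝ ℂ V 1)

/-- `W` is a real Jordan subspace of `A`: for `ω = 0` it has dimension `s` and `A` acts on it as a
single Jordan block with eigenvalue `0`; for `ω ≠ 0` it has dimension `2 * s` and `A` acts on it as
a single real Jordan block for the conjugate pair of eigenvalues `± iω`. -/
def IsRealJordanSubspace (A : Module.End ℝ V) (ω : ℝ) (s : ℕ) (W : Submodule ℝ V) : Prop :=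
  (ω = 0 ∧ ∃ e : Fin s → V, LinearIndependent ℝ e ∧ Submodule.span ℝ (Set.range e) = W ∧
    ∀ j, A (e j) = chainPred e j) ∨
  (ω ≠ 0 ∧ ∃ u v : Fin s → V, LinearIndependent ℝ (Sum.elim u v) ∧
    Submodule.span ℝ (Set.range (Sum.elim u v)) = W ∧
    ∀ j, A (u j) = ω • v j + chainPred u j ∧ A (v j) = -(ω • u j) + chainPred v j)

/-- A real Jordan decomposition of an endomorphism with imaginary eigenvalues: `V` is the direct
sum of finitely many nonzero real Jordan subspaces, the `i`-th one of size `size i`, for the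
eigenvalue pair `± i * freq i`. -/
structure RealJordanDecomposition (A : Module.End ℝ V) where
  num : ℕ
  size : Fin num → ℕ
  size_pos : ∀ i, 0 < size i
  freq : Fin num → ℝ
  freq_nonneg : ∀ i, 0 ≤ freq i
  block : Fin num → Submodule ℝ V
  isJordan : ∀ i, IsRealJordanSubspace A (freq i) (size i) (block i)
  isInternal : DirectSum.IsInternal block

namespace RealJordanDecomposition

variable {A : Module.End ℝ V}

/-- The subspace `J_s`: the sum of all Jordan subspaces of size `s` of the decomposition. -/
def J (D : RealJordanDecomposition A) (s : ℕ) : Submodule ℝ V :=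
  ⨆ (i : Fin D.num) (_ : D.size i = s), D.block i

/-- The dimension of the sum of the real eigenspaces inside `J_s`. -/
def d (D : RealJordanDecomposition A) (s : ℕ) : ℕ :=
  Module.finrank ℝ (⨆ ω : ℝ, realEigenspace A ω ⊓ D.J s : Submodule ℝ V)

end RealJordanDecomposition

/-- The number `d_s` of `A` is well defined and equal to `m`: real Jordan decompositions of `A`
exist, and each of them gives the value `m`. -/
def HasJordanDim (A : Module.End ℝ V) (s m : ℕ) : Prop :=
  Nonempty (RealJordanDecomposition A) ∧ ∀ D : RealJordanDecomposition A, D.d s = m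

end Jordan

end ProjFlow

end

/-! A real Jordan decomposition writes `A = S + N` with commuting `S` and `N`, where `S` rotates the
blocks, so that `exp (tS)` is bounded, and `N` is nilpotent. If `N ^ k x` is the last nonzero power
applied to `x`, then `exp (tN) x` grows like `t ^ k / k! • N ^ k x`. Projectively, the orbit of `x`
therefore follows the orbit of `N ^ k x`, a vector of `ker N`. Two facts result: the recurrent
points are exactly those of `ℙ (ker N)` (`mapClusterPt_iff`), and for `y ∈ ker N` the points
asymptotic to `ℙ y` are the `ℙ x` for which some `N ^ k x` is a nonzero multiple of `y`
(`asymptotic_iff`). Recurrence and the relation `Asymptotic`, stated with ultrafilter limits only,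
are preserved by conjugacies.

Let `C j = ker N ∩ range (N ^ j)`, called `chainEnds N j`. A conjugacy maps `ℙ (C 0)` onto its
counterpart because these are the recurrent points. For a point of `ℙ (C j)`, membership in `ℙ (C (j
+ 1))` is visible from the dimension of its asymptotic class: the class contains an injective image
of a Euclidean space of dimension `dim ker (N ^ j) + 1` exactly when the point lies in `ℙ (C (j +
1))` (`mem_projSet_chainEnds_succ_iff`). By induction all `ℙ (C j)` correspond, and a homeomorphism
that matches projective subspaces preserves their dimensions, hence `dim C j` is an invariant
(`finrank_chainEnds_eq`). Both dimension arguments rest on invariance of dimension, which is derived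
from the absence of a `C¹` retraction onto the sphere.

The numbers `dim C j` determine the Jordan data: `C j` is the sum of the pieces of `ker N` in blocks
of size greater than `j`, so `d (s + 1) = dim C s - dim C (s + 1)`, and a complex Jordan subspace of
dimension `s + 1` exists if and only if `C s ≠ 0`. Existence of decompositions comes from the
structure theorem for torsion modules over `ℝ[X]`. -/

namespace ProjFlow

/-! ### Invariance of dimension -/

section InvarianceOfDimension

open Set MeasureTheory Module

/-- The determinant of `1 + t • M` is a polynomial in `t`, so that it is determined by its values at
`finrank + 1` points. -/
theorem exists_det_one_add_eq_sum (E : Type*) [NormedAddCommGroup E] [NormedSpace ℝ E]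
    [FiniteDimensional ℝ E] (τ : ℕ → ℝ) (hτ : Function.Injective τ) :
    ∃ c : ℕ → ℝ, ∑ j ∈ Finset.range (finrank ℝ E + 1), c j = 1 ∧ ∀ M : E →L[ℝ] E,
      (1 + M).det = ∑ j ∈ Finset.range (finrank ℝ E + 1), c j * (1 + τ j • M).det := by
  set s := Finset.range (finrank ℝ E + 1)
  -- The coefficients express the value at `1` of a polynomial of degree at most `finrank` through
  -- its values at the nodes; interpolating the constant `1` shows that they sum to `1`.
  refine ⟨fun j => (Lagrange.basis s τ j).eval 1, ?_, fun M => ?_⟩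
  · rw [← Polynomial.eval_finsetSum, Lagrange.sum_basis hτ.injOn ⟨0, by simp [s]⟩,
      Polynomial.eval_one]
  · let b := finBasis ℝ E
    let T : Matrix (Fin (finrank ℝ E)) (Fin (finrank ℝ E)) ℝ :=
      LinearMap.toMatrix b b (M : E →ₗ[ℝ] E)
    let q : Polynomial ℝ := ((Polynomial.X : Polynomial ℝ) • T.map Polynomial.C +
      (1 : Matrix _ _ ℝ).map Polynomial.C).det
    have hq (t : ℝ) : q.eval t = (1 + t • M).det := by
      have h1 : (1 + t • M).det = (t • T + 1).det := by
        change LinearMap.det ((1 + t • M : E →L[ℝ] E) : E →ₗ[ℝ] E) = _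
        rw [← LinearMap.det_toMatrix b]
        congr 1
        have : ((1 + t • M : E →L[ℝ] E) : E →ₗ[ℝ] E) = t • (M : E →ₗ[ℝ] E) + 1 := by
          ext x; simp [add_comm]
        rw [this, map_add, map_smul, LinearMap.toMatrix_one]
      rw [h1, ← Polynomial.coe_evalRingHom, RingHom.map_det]
      congr 1
      ext i j
      rcases eq_or_ne i j with h | h
      · subst h; simp [mul_comm t]
      · simp [h, mul_comm t]
    have hdeg : q.degree < s.card := by
      refine (Polynomial.degree_le_natDegree).trans_lt ?_
      have := Polynomial.natDegree_det_X_add_C_le T 1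
      rw [Fintype.card_fin] at this
      simp only [s, Finset.card_range]
      exact_mod_cast Nat.lt_succ_of_le this
    have := congrArg (Polynomial.eval 1) (Lagrange.eq_interpolate (v := τ) hτ.injOn hdeg)
    rw [hq 1, Lagrange.interpolate_apply, Polynomial.eval_finsetSum, one_smul] at this
    rw [this]
    refine Finset.sum_congr rfl fun j _ => ?_
    rw [Polynomial.eval_mul, Polynomial.eval_C, hq, mul_comm]

/-- Along the segment from `1` to `1 + M` every operator is invertible by the Neumann series, so the
determinant cannot change sign from its value `1` at the start. -/
theorem det_one_add_pos {E : Type*} [NormedAddCommGroup E] [NormedSpace ℝ E]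
    [FiniteDimensional ℝ E] (M : E →L[ℝ] E) (hM : ‖M‖ < 1) : 0 < (1 + M).det := by
  have := FiniteDimensional.complete ℝ E
  have hne : ∀ t ∈ Icc (0 : ℝ) 1, (1 + t • M).det ≠ 0 := by
    intro t ht
    have hlt : ‖-(t • M)‖ < 1 := by
      rw [norm_neg, norm_smul, Real.norm_of_nonneg ht.1]
      nlinarith [ht.2, norm_nonneg M]
    have hu : IsUnit (1 + t • M) := by
      simpa using isUnit_one_sub_of_norm_lt_one hlt
    obtain ⟨u, hu⟩ := hu
    have h2 : (u : E →L[ℝ] E).det * ((u⁻¹ : (E →L[ℝ] E)ˣ) : E →L[ℝ] E).det = 1 := by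
      change LinearMap.det _ * LinearMap.det _ = 1
      rw [← LinearMap.det_comp, ← ContinuousLinearMap.toLinearMap_comp]
      have : (u : E →L[ℝ] E).comp ((u⁻¹ : (E →L[ℝ] E)ˣ) : E →L[ℝ] E) = 1 := u.mul_inv
      rw [this]
      exact LinearMap.det_id
    rw [← hu]
    exact left_ne_zero_of_mul_eq_one h2
  have hcont : ContinuousOn (fun t : ℝ => (1 + t • M).det) (Icc 0 1) := by
    have : Continuous fun t : ℝ => (1 + t • M).det :=
      ContinuousLinearMap.continuous_det.comp (by fun_prop)
    exact this.continuousOn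
  by_contra! hle
  have h0 : (0 : ℝ) ∈ Icc ((1 + (1 : ℝ) • M).det) ((1 + (0 : ℝ) • M).det) := by
    refine ⟨by simpa using hle, ?_⟩
    have : (1 + (0 : ℝ) • M).det = 1 := by
      rw [zero_smul, add_zero]; exact LinearMap.det_id
    rw [this]; exact zero_le_one
  obtain ⟨t, ht, h⟩ := intermediate_value_Icc' zero_le_one hcont h0
  exact hne t ht h

/-- There is no continuously differentiable retraction onto the unit sphere. -/
theorem not_contDiff_retraction_sphere {E : Type*} [NormedAddCommGroup E] [InnerProductSpace ℝ E]
    [FiniteDimensional ℝ E] {r : E → E} (hr : ContDiff ℝ 1 r) (hnorm : ∀ x, ‖r x‖ = 1)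
    (hfix : ∀ x, ‖x‖ = 1 → r x = x) : False := by
  have := FiniteDimensional.complete ℝ E
  borelize E
  have hne : Nontrivial E := ⟨r 0, 0, fun h => by simpa [h] using hnorm 0⟩
  set B := Metric.ball (0 : E) 1 with hB
  set D : E → E →L[ℝ] E := fun x => fderiv ℝ r x - 1 with hD
  have hDc : Continuous D := (hr.continuous_fderiv one_ne_zero).sub continuous_const
  have hDr (x : E) : HasFDerivAt (fun x => r x - x) (D x) x :=
    ((hr.differentiable one_ne_zero x).hasFDerivAt).sub (hasFDerivAt_id x)
  obtain ⟨C, hC⟩ := (isCompact_closedBall (0 : E) 1).exists_bound_of_continuousOn hDc.continuousOn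
  set L : ℝ := max C 1
  have hL : 0 < L := lt_of_lt_of_le one_pos (le_max_right _ _)
  have hDL : ∀ x ∈ Metric.closedBall (0 : E) 1, ‖D x‖ ≤ L := fun x hx =>
    (hC x hx).trans (le_max_left _ _)
  -- Straight-line homotopy from the identity to `r`. For small `t` it maps the ball bijectively
  -- onto itself, so its Jacobian integrates to the volume of the ball. This integral is polynomial
  -- in `t`, so the same holds at `t = 1`, where the Jacobian vanishes.
  set h : ℝ → E → E := fun t x => x + t • (r x - x) with hh
  have hder (t : ℝ) (x : E) : HasFDerivAt (h t) (1 + t • D x) x :=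
    (hasFDerivAt_id x).add ((hDr x).const_smul t)
  have hvol : ∀ t : ℝ, 0 ≤ t → t * L < 1 →
      ∫ x in B, (1 + t • D x).det = (volume B).toReal := by
    intro t ht0 htL
    have ht1 : t < 1 := by
      have : 1 ≤ L := le_max_right _ _
      nlinarith
    have happ : ApproximatesLinearOn (h t)
        ((ContinuousLinearEquiv.refl ℝ E : E ≃L[ℝ] E) : E →L[ℝ] E)
        (Metric.closedBall 0 1) (t * L).toNNReal := by
      intro x hx y hy
      have := (convex_closedBall (0 : E) 1).norm_image_sub_le_of_norm_hasFDerivWithin_le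
        (fun z hz => (hDr z).hasFDerivWithinAt) hDL hy hx
      rw [Real.coe_toNNReal _ (by positivity)]
      have e : h t x - h t y - ((ContinuousLinearEquiv.refl ℝ E : E ≃L[ℝ] E) : E →L[ℝ] E) (x - y) =
          t • ((r x - x) - (r y - y)) := by
        simp only [hh, ContinuousLinearEquiv.coe_refl, ContinuousLinearMap.coe_id', id_eq, smul_sub]
        abel
      rw [e, norm_smul, Real.norm_of_nonneg ht0, mul_assoc]
      exact mul_le_mul_of_nonneg_left this ht0
    have hcst : (t * L).toNNReal <
        ‖((ContinuousLinearEquiv.refl ℝ E).symm : E →L[ℝ] E)‖₊⁻¹ := by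
      have h1 : ‖((ContinuousLinearEquiv.refl ℝ E).symm : E →L[ℝ] E)‖₊ = 1 := by
        rw [ContinuousLinearEquiv.refl_symm, ContinuousLinearEquiv.coe_refl]
        exact nnnorm_one
      rw [h1, inv_one, Real.toNNReal_lt_one]
      exact htL
    have hinj : InjOn (h t) (Metric.closedBall 0 1) := happ.injOn (Or.inr hcst)
    have hopen : IsOpen (h t '' B) :=
      (happ.mono_set Metric.ball_subset_closedBall).open_image
        (ContinuousLinearEquiv.toNonlinearRightInverse _) Metric.isOpen_ball (Or.inr hcst)
    have hcont : Continuous (h t) :=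
      continuous_id.add ((hr.continuous.sub continuous_id).const_smul t)
    have hmaps : h t '' B ⊆ B := by
      rintro _ ⟨x, hx, rfl⟩
      rw [hB, mem_ball_zero_iff] at hx ⊢
      have e : h t x = (1 - t) • x + t • r x := by
        simp only [hh, smul_sub, sub_smul, one_smul]; abel
      rw [e]
      calc _ ≤ ‖(1 - t) • x‖ + ‖t • r x‖ := norm_add_le _ _
        _ = (1 - t) * ‖x‖ + t := by
          rw [norm_smul, norm_smul, Real.norm_of_nonneg ht0, hnorm,
            Real.norm_of_nonneg (by linarith), mul_one]
        _ < 1 := by nlinarith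
    -- The sphere is fixed pointwise, so the connected ball is covered by two disjoint open sets:
    -- the image of the open ball and the complement of the image of the closed ball. The first one
    -- meets it.
    have himage : h t '' B = B := by
      refine hmaps.antisymm ?_
      have hclosed : IsOpen (h t '' Metric.closedBall 0 1)ᶜ :=
        ((isCompact_closedBall (0 : E) 1).image hcont).isClosed.isOpen_compl
      refine IsPreconnected.subset_left_of_subset_union hopen hclosed ?_ ?_ ?_
        (convex_ball (0 : E) 1).isPreconnected
      · exact disjoint_compl_right_iff_subset.2 (image_mono Metric.ball_subset_closedBall)
      · intro y hy
        by_cases hy' : y ∈ h t '' Metric.closedBall 0 1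
        · left
          obtain ⟨x, hx, rfl⟩ := hy'
          refine ⟨x, ?_, rfl⟩
          rw [mem_closedBall_zero_iff] at hx
          rw [hB, mem_ball_zero_iff]
          refine lt_of_le_of_ne hx fun h1 => ?_
          have : h t x = x := by simp [hh, hfix x h1]
          rw [this, mem_ball_zero_iff] at hy
          exact hy.ne h1
        · exact Or.inr hy'
      · have h0 : (0 : E) ∈ B := by simp [hB]
        exact ⟨h t 0, hmaps ⟨0, h0, rfl⟩, 0, h0, rfl⟩
    have hcv := integral_image_eq_integral_abs_det_fderiv_smul volume
      (Metric.isOpen_ball.measurableSet : MeasurableSet B)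
      (fun x _ => (hder t x).hasFDerivWithinAt)
      (hinj.mono Metric.ball_subset_closedBall) (fun _ => (1 : ℝ))
    rw [himage] at hcv
    simp only [smul_eq_mul, mul_one, integral_const, measureReal_restrict_apply_univ] at hcv
    have hreal : volume.real B = (volume B).toReal := rfl
    rw [← hreal, hcv]
    refine setIntegral_congr_fun Metric.isOpen_ball.measurableSet fun x hx => ?_
    refine (abs_of_pos (det_one_add_pos _ ?_)).symm
    rw [norm_smul, Real.norm_of_nonneg ht0]
    exact (mul_le_mul_of_nonneg_left (hDL x (Metric.ball_subset_closedBall hx)) ht0).trans_lt htL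
  -- Distinct nodes, all below the bound `1 / L` under which the volume identity is known.
  have hτ : Function.Injective fun j : ℕ => 1 / ((j + 2 : ℝ) * L) := by
    intro i j hij
    have h1 : ((i : ℝ) + 2) * L = (j + 2) * L := by
      have := congrArg (fun z : ℝ => 1 / z) hij
      simpa using this
    have h2 := mul_right_cancel₀ hL.ne' h1
    exact_mod_cast (add_right_cancel h2)
  obtain ⟨c, hc1, hc⟩ := exists_det_one_add_eq_sum E _ hτ
  -- Differentiating `‖r‖ ^ 2 = 1` shows that the range of the derivative is orthogonal to `r x`, so
  -- the derivative is not surjective.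
  have hdet0 (x : E) : (1 + D x).det = 0 := by
    have e : (1 + D x) = fderiv ℝ r x := by simp [hD]
    rw [e]
    by_contra hne0
    have hsurj : Function.Surjective (fderiv ℝ r x) := by
      have hu : IsUnit (LinearMap.det (fderiv ℝ r x : E →ₗ[ℝ] E)) := isUnit_iff_ne_zero.2 hne0
      exact (LinearEquiv.ofIsUnitDet (f := (fderiv ℝ r x : E →ₗ[ℝ] E))
        (v := finBasis ℝ E) (v' := finBasis ℝ E)
        (by rwa [LinearMap.det_toMatrix])).surjective
    obtain ⟨v, hv⟩ := hsurj (r x)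
    have h1 : HasFDerivAt (fun y => ‖r y‖ ^ 2) _ x :=
      ((hr.differentiable one_ne_zero x).hasFDerivAt).norm_sq
    have h2 : HasFDerivAt (fun y => ‖r y‖ ^ 2) (0 : E →L[ℝ] ℝ) x := by
      simp only [hnorm]
      exact hasFDerivAt_const _ _
    have h3 := congrArg (fun f : E →L[ℝ] ℝ => f v) (h1.unique h2)
    simp [hv, hnorm] at h3
  have hint (t : ℝ) : IntegrableOn (fun x => (1 + t • D x).det) B := by
    have : Continuous fun x => (1 + t • D x).det :=
      ContinuousLinearMap.continuous_det.comp
        (continuous_const.add (hDc.const_smul t))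
    exact (this.continuousOn.integrableOn_compact (isCompact_closedBall (0 : E) 1)).mono_set
      Metric.ball_subset_closedBall
  have hlt (j : ℕ) : 1 / ((j + 2 : ℝ) * L) * L < 1 := by
    rw [one_div, mul_inv, mul_assoc, inv_mul_cancel₀ hL.ne', mul_one]
    exact inv_lt_one_of_one_lt₀ (by linarith [(Nat.cast_nonneg j : (0 : ℝ) ≤ j)])
  have key : ∫ x in B, (1 + D x).det = (volume B).toReal := by
    rw [funext fun x => hc (D x)]
    rw [integral_finsetSum _ fun j _ => (hint _).const_mul _]
    simp_rw [integral_const_mul]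
    rw [Finset.sum_congr rfl fun j _ => by rw [hvol _ (by positivity) (hlt j)], ← Finset.sum_mul, hc1,
      one_mul]
  simp_rw [hdet0] at key
  rw [integral_zero] at key
  exact (ENNReal.toReal_pos (Metric.measure_ball_pos volume _ one_pos).ne'
    measure_ball_lt_top.ne).ne key

/-- The balls around the values of `f` are convex and constants are local solutions, so a smooth
partition of unity glues them. -/
theorem exists_contDiff_dist_lt {E F : Type*} [NormedAddCommGroup E] [NormedSpace ℝ E]
    [FiniteDimensional ℝ E] [NormedAddCommGroup F] [NormedSpace ℝ F] {f : E → F}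
    (hf : Continuous f) {ε : ℝ} (hε : 0 < ε) :
    ∃ g : E → F, ContDiff ℝ 1 g ∧ ∀ x, dist (g x) (f x) < ε := by
  obtain ⟨g, hg⟩ := exists_contMDiffMap_forall_mem_convex_of_local_const (n := 1)
    (modelWithCornersSelf ℝ E) (t := fun x => Metric.ball (f x) ε) (fun x => convex_ball _ _)
    fun x => ⟨f x, (hf.continuousAt.eventually (Metric.ball_mem_nhds (f x) hε)).mono
      fun y hy => by simpa [dist_comm] using hy⟩
  exact ⟨g, g.contMDiff.contDiff, fun x => hg x⟩

/-- **Invariance of dimension**: an open set of a Euclidean space does not embed into a space of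
smaller dimension. -/
theorem finrank_le_of_continuousOn_of_injOn {E F : Type*} [NormedAddCommGroup E]
    [InnerProductSpace ℝ E] [FiniteDimensional ℝ E] [NormedAddCommGroup F] [NormedSpace ℝ F]
    [FiniteDimensional ℝ F] {U : Set E} (hU : IsOpen U) (hne : U.Nonempty) {f : E → F}
    (hf : ContinuousOn f U) (hinj : InjOn f U) : finrank ℝ E ≤ finrank ℝ F := by
  by_contra! hlt
  obtain ⟨x₀, hx₀⟩ := hne
  obtain ⟨ρ, hρ, hρU⟩ := Metric.nhds_basis_closedBall.mem_iff.1 (hU.mem_nhds hx₀)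
  set K := Metric.closedBall (0 : E) 1 with hK
  have hmaps : MapsTo (fun x => x₀ + ρ • x) K U := fun x hx => by
    refine hρU ?_
    rw [hK, mem_closedBall_zero_iff] at hx
    rw [mem_closedBall_iff_norm, add_sub_cancel_left, norm_smul, Real.norm_of_nonneg hρ.le]
    nlinarith
  have hφc : ContinuousOn (fun x => f (x₀ + ρ • x)) K := hf.comp (by fun_prop) hmaps
  have hφi : InjOn (fun x => f (x₀ + ρ • x)) K := fun x hx y hy hxy => by
    have := hinj (hmaps hx) (hmaps hy) hxy
    exact smul_right_injective E hρ.ne' (add_left_cancel this)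
  have hKc : IsCompact K := isCompact_closedBall _ _
  have : CompactSpace K := isCompact_iff_compactSpace.1 hKc
  have : TietzeExtension F := TietzeExtension.of_tvs ℝ
  have : TietzeExtension E := TietzeExtension.of_tvs ℝ
  let e : C(K, F) := ⟨K.domRestrict fun x => f (x₀ + ρ • x), hφc.domRestrict⟩
  have he : Topology.IsClosedEmbedding e :=
    e.continuous.isClosedEmbedding (injOn_iff_injective.1 hφi)
  -- By Tietze, `g` extends the embedding of the closed ball to `E` and `p` extends its inverse to
  -- `F`; thus `p ∘ g` is the identity on the ball.
  obtain ⟨g, hg⟩ := ContinuousMap.exists_restrict_eq hKc.isClosed e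
  obtain ⟨p, hp⟩ := ContinuousMap.exists_extension' he (⟨Subtype.val, continuous_subtype_val⟩ : C(K, E))
  have hpg : ∀ x ∈ K, p (g x) = x := fun x hx => by
    have h1 : g x = e ⟨x, hx⟩ := congrArg (fun q : C(K, F) => q ⟨x, hx⟩) hg
    rw [h1]
    exact congrFun hp ⟨x, hx⟩
  obtain ⟨P, hP, hPp⟩ := exists_contDiff_dist_lt p.continuous (by norm_num : (0 : ℝ) < 1 / 8)
  have huc := (hKc.image g.continuous).uniformContinuousAt_of_continuousAt p
    (fun _ _ => p.continuous.continuousAt)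
    (Metric.dist_mem_uniformity (by norm_num : (0 : ℝ) < 1 / 8))
  obtain ⟨δ, hδ, hδp⟩ := Metric.mem_uniformity_dist.1 huc
  obtain ⟨g', hg', hg'g⟩ := exists_contDiff_dist_lt g.continuous hδ
  -- A `C¹` map from the lower-dimensional `F` has a range with dense complement, so a small shift
  -- `c` makes `P ∘ g' - c` nowhere zero. The errors `1/8`, `1/8` and `1/4` add up to `1/2`.
  obtain ⟨c, hc, hc0⟩ := (hP.dense_compl_range_of_finrank_lt_finrank hlt).exists_dist_lt 0
    (by norm_num : (0 : ℝ) < 1 / 4)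
  let q : E → E := fun x => P (g' x) - c
  have hq : ContDiff ℝ 1 q := (hP.comp hg').sub contDiff_const
  have hq0 : ∀ x, q x ≠ 0 := fun x h => hc ⟨g' x, sub_eq_zero.1 h⟩
  have hqx : ∀ x ∈ K, ‖q x - x‖ ≤ 1 / 2 := fun x hx => by
    have h1 := hPp (g' x)
    have h2 := hδp (by rw [dist_comm]; exact hg'g x) ⟨x, hx, rfl⟩
    simp only [mem_ofPred_eq] at h2
    rw [hpg x hx] at h2
    rw [dist_eq_norm] at h1 h2 hc0
    have e : q x - x = (P (g' x) - p (g' x)) + (-(x - p (g' x)) + (0 - c)) := by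
      simp only [q]; abel
    rw [e]
    refine (norm_add_le _ _).trans ?_
    have := norm_add_le (-(x - p (g' x))) (0 - c)
    rw [norm_neg] at this
    linarith
  -- The map `G` is `q` on the ball of radius `3/4` and the identity outside the unit ball. In the
  -- shell between, `‖x‖ > 3/4` exceeds the deviation `1/2`, so `G` has no zero and `G / ‖G‖` is a
  -- forbidden retraction.
  let χ : ContDiffBump (0 : E) := ⟨3 / 4, 1, by norm_num, by norm_num⟩
  let G : E → E := fun x => x + χ x • (q x - x)
  have hG : ContDiff ℝ 1 G := contDiff_id.add (χ.contDiff.smul (hq.sub contDiff_id))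
  have hGout : ∀ x, 1 ≤ ‖x‖ → G x = x := fun x hx => by
    have : χ x = 0 := χ.zero_of_le_dist (by simpa using hx)
    simp [G, this]
  have hG0 : ∀ x, G x ≠ 0 := fun x => by
    rcases le_or_gt 1 ‖x‖ with h1 | h1
    · rw [hGout x h1, ← norm_pos_iff]
      linarith
    · rcases le_or_gt ‖x‖ (3 / 4) with h2 | h2
      · have : χ x = 1 := χ.one_of_mem_closedBall (by simpa using h2)
        have e : G x = q x := by simp [G, this]
        rw [e]
        exact hq0 x
      · have h3 := hqx x (by rw [hK, mem_closedBall_zero_iff]; exact h1.le)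
        have h4 : ‖χ x • (q x - x)‖ ≤ 1 / 2 := by
          rw [norm_smul, Real.norm_of_nonneg χ.nonneg]
          calc _ ≤ 1 * ‖q x - x‖ := mul_le_mul_of_nonneg_right χ.le_one (norm_nonneg _)
            _ ≤ _ := by linarith
        intro h0
        have h5 : x = -(χ x • (q x - x)) := eq_neg_of_add_eq_zero_left h0
        have h6 := congrArg norm h5
        rw [norm_neg] at h6
        linarith
  refine not_contDiff_retraction_sphere (r := fun x => ‖G x‖⁻¹ • G x) ?_ (fun x => ?_)
    fun x hx => ?_
  · exact ((hG.norm ℝ hG0).inv fun x => norm_ne_zero_iff.2 (hG0 x)).smul hG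
  · rw [norm_smul, norm_inv, norm_norm, inv_mul_cancel₀ (norm_ne_zero_iff.2 (hG0 x))]
  · simp only [hGout x hx.ge, hx, inv_one, one_smul]

end InvarianceOfDimension

/-! ### Topology of projective space -/

section Projective

open Filter Topology Module

variable {V : Type*} [NormedAddCommGroup V] [NormedSpace ℝ V]

/-- Two vectors are proportional exactly when `f x * g y = f y * g x` for all functionals `f` and
`g`, which is a closed condition, and the quotient map is open. -/
instance instT2SpaceProj : T2Space (ℙ ℝ V) := by
  rw [t2Space_iff_of_isOpenQuotientMap isOpenQuotientMap_mk']
  have : {q : {v : V // v ≠ 0} × {v : V // v ≠ 0} |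
      Projectivization.mk' ℝ q.1 = Projectivization.mk' ℝ q.2} =
      ⋂ (f : StrongDual ℝ V) (g : StrongDual ℝ V),
        {q | f (q.1 : V) * g (q.2 : V) = f (q.2 : V) * g (q.1 : V)} := by
    ext ⟨⟨x, hx⟩, y, hy⟩
    simp only [Set.mem_ofPred_eq, Set.mem_iInter, Projectivization.mk'_eq_mk,
      Projectivization.mk_eq_mk_iff']
    constructor
    · rintro ⟨a, rfl⟩ f g
      simp only [map_smul, smul_eq_mul]
      ring
    · intro h
      obtain ⟨f, hf⟩ := SeparatingDual.exists_ne_zero (R := ℝ) hy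
      refine ⟨f x / f y, ?_⟩
      rw [← sub_eq_zero]
      by_contra hne
      obtain ⟨g, hg⟩ := SeparatingDual.exists_ne_zero (R := ℝ) hne
      apply hg
      rw [map_sub, map_smul, smul_eq_mul, div_mul_eq_mul_div, h f g]
      field_simp
      ring
  rw [this]
  refine isClosed_iInter fun f => isClosed_iInter fun g => isClosed_eq ?_ ?_ <;> fun_prop

theorem tendsto_mk_of_smul {ι : Type*} {l : Filter ι} {f : ι → V} (hf : ∀ i, f i ≠ 0)
    {c : ι → ℝ} (hc : ∀ᶠ i in l, c i ≠ 0) {v : V} (hv : v ≠ 0)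
    (h : Tendsto (fun i => c i • f i) l (𝓝 v)) :
    Tendsto (fun i => Projectivization.mk ℝ (f i) (hf i)) l (𝓝 (Projectivization.mk ℝ v hv)) := by
  classical
  let f' : ι → {v : V // v ≠ 0} := fun i =>
    if hi : c i = 0 then ⟨f i, hf i⟩ else ⟨c i • f i, smul_ne_zero hi (hf i)⟩
  have h1 : Tendsto f' l (𝓝 ⟨v, hv⟩) := by
    rw [tendsto_subtype_rng]
    refine h.congr' (hc.mono fun i hi => ?_)
    simp [f', hi]
  refine ((isQuotientMap_mk'.continuous.tendsto _).comp h1).congr fun i => ?_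
  by_cases hi : c i = 0
  · simp [f', hi]
  · simp only [f', hi, Function.comp, dite_false, Projectivization.mk'_eq_mk]
    exact (Projectivization.mk_eq_mk_iff' ℝ _ _ _ _).2 ⟨c i, rfl⟩

/-- The projective subspace defined by a linear subspace. -/
def projSet (W : Submodule ℝ V) : Set (ℙ ℝ V) := {p | p.submodule ≤ W}

theorem mk_mem_projSet {W : Submodule ℝ V} {x : V} (hx : x ≠ 0) :
    Projectivization.mk ℝ x hx ∈ projSet W ↔ x ∈ W := by
  simp [projSet, Projectivization.submodule_mk]

/-- The set `X` contains a continuous injective image of `ℝ^d`. -/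
def ContainsEuclidean {P : Type*} [TopologicalSpace P] (d : ℕ) (X : Set P) : Prop :=
  ∃ f : EuclideanSpace ℝ (Fin d) → P, Continuous f ∧ Function.Injective f ∧ ∀ y, f y ∈ X

theorem ContainsEuclidean.mono {P : Type*} [TopologicalSpace P] {d : ℕ} {X Y : Set P}
    (h : ContainsEuclidean d X) (hXY : X ⊆ Y) : ContainsEuclidean d Y :=
  let ⟨f, hc, hi, hf⟩ := h
  ⟨f, hc, hi, fun y => hXY (hf y)⟩

theorem ContainsEuclidean.homeomorph {P Q : Type*} [TopologicalSpace P] [TopologicalSpace Q]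
    {d : ℕ} {X : Set P} {Y : Set Q} (e : P ≃ₜ Q) (he : ∀ p ∈ X, e p ∈ Y)
    (h : ContainsEuclidean d X) : ContainsEuclidean d Y :=
  let ⟨f, hc, hi, hf⟩ := h
  ⟨e ∘ f, e.continuous.comp hc, e.injective.comp hi, fun y => he _ (hf y)⟩

/-- The affine subspace `x₀ + W` misses the origin and meets each line through it at most once, so
it embeds into projective space. -/
theorem containsEuclidean_of_affine [FiniteDimensional ℝ V] {W : Submodule ℝ V} {x₀ : V}
    (hx₀ : x₀ ∉ W) {d : ℕ} (hd : d ≤ finrank ℝ W) {X : Set (ℙ ℝ V)}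
    (hX : ∀ y ∈ W, ∀ h : x₀ + y ≠ 0, Projectivization.mk ℝ (x₀ + y) h ∈ X) :
    ContainsEuclidean d X := by
  let b : Fin d → W := finBasis ℝ W ∘ Fin.castLE hd
  have hb : LinearIndependent ℝ b :=
    (finBasis ℝ W).linearIndependent.comp _ (Fin.castLE_injective hd)
  let g : EuclideanSpace ℝ (Fin d) →ₗ[ℝ] V :=
    W.subtype ∘ₗ Fintype.linearCombination ℝ b ∘ₗ (WithLp.linearEquiv 2 ℝ (Fin d → ℝ)).toLinearMap
  have hg : Function.Injective g :=
    W.subtype_injective.comp (hb.fintypeLinearCombination_injective.comp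
      (WithLp.linearEquiv 2 ℝ (Fin d → ℝ)).injective)
  have hgW : ∀ z, g z ∈ W := fun z => Subtype.coe_prop _
  have hne : ∀ y ∈ W, x₀ + y ≠ 0 := fun y hy h => hx₀ (by
    rw [eq_neg_of_add_eq_zero_left h]; exact W.neg_mem hy)
  refine ⟨fun z => Projectivization.mk ℝ (x₀ + g z) (hne _ (hgW z)), ?_, fun z z' h => ?_,
    fun z => hX _ (hgW z) _⟩
  · have : Continuous fun z => (⟨x₀ + g z, hne _ (hgW z)⟩ : {v : V // v ≠ 0}) :=
      (continuous_const.add g.continuous_of_finiteDimensional).subtype_mk _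
    exact isQuotientMap_mk'.continuous.comp this
  · obtain ⟨a, ha⟩ := (Projectivization.mk_eq_mk_iff' ℝ _ _ _ _).1 h
    have h1 : (a - 1) • x₀ = g z - a • g z' := by
      rw [sub_smul, one_smul, sub_eq_sub_iff_add_eq_add, ← smul_add, ha, add_comm]
    have h2 : a = 1 := by
      by_contra hne1
      apply hx₀
      rw [← inv_smul_smul₀ (sub_ne_zero.2 hne1) x₀, h1]
      exact W.smul_mem _ (W.sub_mem (hgW z) (W.smul_mem _ (hgW z')))
    rw [h2, one_smul] at ha
    exact (hg (add_left_cancel ha)).symm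

/-- In an affine chart given by a functional `l` not vanishing on `W`, the projective subspace of
`W` becomes a translate of `W ∩ ker l`, which has smaller dimension than `W`; invariance of
dimension applies there. -/
theorem ContainsEuclidean.lt_finrank [FiniteDimensional ℝ V] {W : Submodule ℝ V} {d : ℕ}
    (h : ContainsEuclidean d (projSet W)) : d < finrank ℝ W := by
  obtain ⟨f, hc, hi, hf⟩ := h
  obtain ⟨x, hx, hfx⟩ : ∃ (x : V) (hx : x ≠ 0), Projectivization.mk ℝ x hx = f 0 :=
    ⟨_, _, (f 0).mk_rep⟩
  obtain ⟨l, hl⟩ := SeparatingDual.exists_ne_zero (R := ℝ) hx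
  have hxW : x ∈ W := (mk_mem_projSet hx).1 (hfx ▸ hf 0)
  let χ : ℙ ℝ V → V := Projectivization.lift (fun v => (l v)⁻¹ • (v : V)) (by
    rintro ⟨v, hv⟩ ⟨w, hw⟩ t (rfl : v = t • w)
    have ht : t ≠ 0 := fun h0 => hv (by simp [h0])
    simp only [map_smul, smul_eq_mul, smul_smul]
    congr 1
    rw [mul_inv, mul_right_comm, inv_mul_cancel₀ ht, one_mul])
  have hχ (v : V) (hv : v ≠ 0) : χ (Projectivization.mk ℝ v hv) = (l v)⁻¹ • v := rfl
  -- Where `l v = 0` the inverse is `0` and hence `χ` is `0`, so this set is precisely the domain of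
  -- the chart.
  let O : Set (ℙ ℝ V) := {p | l (χ p) ≠ 0}
  have hO (v : V) (hv : v ≠ 0) : Projectivization.mk ℝ v hv ∈ O ↔ l v ≠ 0 := by
    simp [O, hχ]
  have hOo : IsOpen O := by
    rw [← isQuotientMap_mk'.isOpen_preimage]
    have : Projectivization.mk' ℝ ⁻¹' O = {v : {v : V // v ≠ 0} | l (v : V) ≠ 0} := by
      ext v; exact hO v v.2
    rw [this]
    exact isOpen_ne_fun (by fun_prop) continuous_const
  have hχc : ContinuousOn χ O := by
    intro p hp
    induction p using Projectivization.ind with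
    | h v hv =>
      refine ContinuousAt.continuousWithinAt ?_
      refine (isOpenQuotientMap_mk'.continuousAt_comp_iff (x := ⟨v, hv⟩)).1 ?_
      have hlv : l v ≠ 0 := (hO v hv).1 hp
      change ContinuousAt (fun w : {v : V // v ≠ 0} => (l (w : V))⁻¹ • (w : V)) ⟨v, hv⟩
      refine ContinuousAt.smul (ContinuousAt.inv₀ ?_ hlv) ?_ <;> fun_prop
  have hlχ : ∀ p ∈ O, l (χ p) = 1 := by
    intro p hp
    induction p using Projectivization.ind with
    | h v hv => rw [hχ, map_smul, smul_eq_mul, inv_mul_cancel₀ ((hO v hv).1 hp)]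
  have hχW : ∀ p ∈ projSet W, χ p ∈ W := by
    intro p hp
    induction p using Projectivization.ind with
    | h v hv => exact W.smul_mem _ ((mk_mem_projSet hv).1 hp)
  have hχi : ∀ p ∈ O, ∀ q ∈ O, χ p = χ q → p = q := by
    intro p hp q hq
    induction p using Projectivization.ind with
    | h v hv =>
      induction q using Projectivization.ind with
      | h w hw =>
        intro h
        rw [hχ, hχ] at h
        refine (Projectivization.mk_eq_mk_iff' ℝ _ _ _ _).2 ⟨l v * (l w)⁻¹, ?_⟩
        rw [mul_smul, ← h, smul_inv_smul₀ ((hO v hv).1 hp)]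
  let W' : Submodule ℝ V := W ⊓ LinearMap.ker (l : V →ₗ[ℝ] ℝ)
  have hlt : W' < W := by
    refine lt_of_le_of_ne inf_le_left fun h => hl ?_
    have : x ∈ W' := h ▸ hxW
    exact this.2
  obtain ⟨π, hπ⟩ := W'.subtype.exists_leftInverse_of_injective W'.ker_subtype
  have hπi : ∀ v ∈ W', ∀ w ∈ W', π v = π w → v = w := by
    intro v hv w hw h
    have h1 : π v = ⟨v, hv⟩ := LinearMap.congr_fun hπ ⟨v, hv⟩
    have h2 : π w = ⟨w, hw⟩ := LinearMap.congr_fun hπ ⟨w, hw⟩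
    rw [h1, h2] at h
    exact congrArg Subtype.val h
  have h0 : f 0 ∈ O := by rw [← hfx]; exact (hO x hx).2 hl
  have hmem : ∀ y ∈ f ⁻¹' O, χ (f y) - χ (f 0) ∈ W' := fun y hy =>
    ⟨W.sub_mem (hχW _ (hf _)) (hχW _ (hf _)), by
      simp [hlχ _ hy, hlχ _ h0]⟩
  have := finrank_le_of_continuousOn_of_injOn (f := fun y => π (χ (f y) - χ (f 0)))
    (hOo.preimage hc) ⟨0, h0⟩ ?_ ?_
  · rw [finrank_euclideanSpace_fin] at this
    exact this.trans_lt (Submodule.finrank_lt_finrank_of_lt hlt)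
  · exact π.continuous_of_finiteDimensional.comp_continuousOn
      ((hχc.comp hc.continuousOn fun _ h => h).sub continuousOn_const)
  · intro y hy z hz h
    exact hi (hχi _ hy _ hz (sub_left_injective (hπi _ (hmem y hy) _ (hmem z hz) h)))

/-- A homeomorphism that maps a projective subspace into another one does not raise dimension. -/
theorem finrank_le_of_homeomorph [FiniteDimensional ℝ V] {W W' : Submodule ℝ V}
    (e : ℙ ℝ V ≃ₜ ℙ ℝ V) (he : ∀ p ∈ projSet W, e p ∈ projSet W') :
    finrank ℝ W ≤ finrank ℝ W' := by
  rcases eq_or_ne W ⊥ with rfl | hW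
  · simp
  obtain ⟨x, hxW, hx⟩ := W.ne_bot_iff.1 hW
  obtain ⟨l, hl⟩ := SeparatingDual.exists_ne_zero (R := ℝ) hx
  -- The affine space `x + U` is a chart of `ℙ W` of dimension `dim W - 1`; its image in `ℙ W'`
  -- forces `dim W - 1 < dim W'`.
  let U : Submodule ℝ V := W ⊓ LinearMap.ker (l : V →ₗ[ℝ] ℝ)
  have hxU : x ∉ U := fun h => hl h.2
  have hWU : W ≤ U ⊔ Submodule.span ℝ {x} := fun w hw => by
    have : w = (w - (l w / l x) • x) + (l w / l x) • x := by abel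
    rw [this]
    refine add_mem (Submodule.mem_sup_left ⟨W.sub_mem hw (W.smul_mem _ hxW), ?_⟩)
      (Submodule.mem_sup_right (Submodule.smul_mem _ _ (Submodule.mem_span_singleton_self x)))
    simp [hl]
  have h1 : finrank ℝ W ≤ finrank ℝ U + 1 :=
    (Submodule.finrank_mono hWU).trans ((Submodule.finrank_add_le_finrank_add_finrank _ _).trans
      (by rw [finrank_span_singleton hx]))
  have h2 : ContainsEuclidean (finrank ℝ U) (projSet W) :=
    containsEuclidean_of_affine hxU le_rfl fun y hy h =>
      (mk_mem_projSet h).2 (W.add_mem hxW hy.1)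
  exact h1.trans (h2.homeomorph e he).lt_finrank

end Projective

/-! ### Asymptotic and recurrent points of flows -/

section Flows

open Filter Topology

variable {X Y : Type*} [TopologicalSpace X] [TopologicalSpace Y]

/-- The orbits of `x` and `y` have the same limit along each ultrafilter at `+∞` along which both
converge. -/
def Asymptotic (φ : Flow ℝ X) (x y : X) : Prop :=
  ∀ F : Ultrafilter ℝ, (F : Filter ℝ) ≤ atTop → ∀ a b,
    Tendsto (fun t => φ t x) F (𝓝 a) → Tendsto (fun t => φ t y) F (𝓝 b) → a = b

theorem Asymptotic.homeomorph {φ : Flow ℝ X} {ψ : Flow ℝ Y} (h : X ≃ₜ Y)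
    (hc : ∀ t x, h (φ t x) = ψ t (h x)) {x y : X} (hxy : Asymptotic φ x y) :
    Asymptotic ψ (h x) (h y) := by
  intro F hF a b ha hb
  have key : ∀ z c, Tendsto (fun t => ψ t (h z)) F (𝓝 c) →
      Tendsto (fun t => φ t z) F (𝓝 (h.symm c)) := fun z c hz => by
    refine ((h.symm.continuous.tendsto c).comp hz).congr fun t => ?_
    simp [← hc]
  exact h.symm.injective (hxy F hF _ _ (key x a ha) (key y b hb))

theorem conj_symm {φ : Flow ℝ X} {ψ : Flow ℝ Y} {h : X ≃ₜ Y}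
    (hc : ∀ t x, h (φ t x) = ψ t (h x)) (t : ℝ) (y : Y) : h.symm (ψ t y) = φ t (h.symm y) := by
  rw [h.symm_apply_eq, hc, h.apply_symm_apply]

theorem mapClusterPt_flow_homeomorph {φ : Flow ℝ X} {ψ : Flow ℝ Y} (h : X ≃ₜ Y)
    (hc : ∀ t x, h (φ t x) = ψ t (h x)) {x : X} (hx : MapClusterPt x atTop fun t => φ t x) :
    MapClusterPt (h x) atTop fun t => ψ t (h x) := by
  have := hx.continuousAt_comp h.continuous.continuousAt
  exact this.congrFun (Eventually.of_forall fun t => hc t x)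

end Flows

/-! ### Asymptotics of the projective flow -/

section Core

open Filter Topology Module

variable {V : Type*} [NormedAddCommGroup V] [NormedSpace ℝ V]

/-- The vectors of `ker N` that are the end of a chain of `N` of length `j + 1`. -/
def chainEnds {V : Type*} [AddCommGroup V] [Module ℝ V] (N : Module.End ℝ V) (j : ℕ) :
    Submodule ℝ V :=
  LinearMap.ker N ⊓ LinearMap.range (N ^ j)

/-- Rank-nullity for the restriction of `N ^ j` to `ker (N ^ (j + 1))`. -/
theorem finrank_ker_pow_succ [FiniteDimensional ℝ V] (N : Module.End ℝ V) (j : ℕ) :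
    finrank ℝ (LinearMap.ker (N ^ (j + 1))) =
      finrank ℝ (chainEnds N j) + finrank ℝ (LinearMap.ker (N ^ j)) := by
  have h := LinearMap.finrank_range_add_finrank_ker
    ((N ^ j).domRestrict (LinearMap.ker (N ^ (j + 1))))
  have hle : LinearMap.ker (N ^ j) ≤ LinearMap.ker (N ^ (j + 1)) := fun x hx => by
    rw [LinearMap.mem_ker] at hx ⊢
    rw [pow_succ', Module.End.mul_apply, hx, map_zero]
  have h1 : LinearMap.range ((N ^ j).domRestrict (LinearMap.ker (N ^ (j + 1)))) =
      chainEnds N j := by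
    ext y
    constructor
    · rintro ⟨⟨x, hx⟩, rfl⟩
      refine ⟨?_, x, rfl⟩
      rw [LinearMap.mem_ker, pow_succ', Module.End.mul_apply] at hx
      exact hx
    · rintro ⟨hy, x, rfl⟩
      refine ⟨⟨x, ?_⟩, rfl⟩
      rw [LinearMap.mem_ker, pow_succ', Module.End.mul_apply]
      exact hy
  have h2 : LinearMap.ker ((N ^ j).domRestrict (LinearMap.ker (N ^ (j + 1)))) =
      (LinearMap.ker (N ^ j)).comap (LinearMap.ker (N ^ (j + 1))).subtype := rfl
  rw [h1, h2, (Submodule.comapSubtypeEquivOfLe hle).finrank_eq] at h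
  exact h.symm

theorem tendsto_clm_apply {ι : Type*} {l : Filter ι} {f : ι → V →L[ℝ] V} {g : V →L[ℝ] V}
    (hf : Tendsto f l (𝓝 g)) {x : ι → V} {y : V} (hx : Tendsto x l (𝓝 y)) :
    Tendsto (fun i => f i (x i)) l (𝓝 (g y)) :=
  ((isBoundedBilinearMap_apply (𝕜 := ℝ) (E := V) (F := V)).continuous.tendsto (g, y)).comp
    (hf.prodMk_nhds hx)

variable [FiniteDimensional ℝ V]

/-- `A` is the sum of commuting operators `S` and `N`, where `S` generates a bounded flow and `N` is
nilpotent. -/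
structure IsBoundedNilpotentSplit (A S N : Module.End ℝ V) : Prop where
  add_eq : A = S + N
  comm : Commute S N
  nilpotent : IsNilpotent N
  bounded : ∃ C, ∀ t, ‖expMap S t‖ ≤ C

theorem expMap_hasSum (N : Module.End ℝ V) (t : ℝ) (x : V) :
    HasSum (fun n : ℕ => (t ^ n / n.factorial) • (N ^ n) x) (expMap N t x) := by
  have := FiniteDimensional.complete ℝ V
  have h := NormedSpace.exp_series_hasSum_exp' (𝕂 := ℝ) (t • LinearMap.toContinuousLinearMap N)
  have h2 := h.mapL (ContinuousLinearMap.apply ℝ V x)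
  change HasSum _ (ContinuousLinearMap.apply ℝ V x _)
  convert h2 using 1
  funext n
  have hn : ∀ n : ℕ, (LinearMap.toContinuousLinearMap N ^ n) x = (N ^ n) x := by
    intro n
    induction n with
    | zero => rfl
    | succ n ih => rw [pow_succ', pow_succ', Module.End.mul_apply, ← ih]; rfl
  simp only [ContinuousLinearMap.apply_apply, smul_pow, smul_smul, FunLike.coe_smul,
    Pi.smul_apply, hn]
  rw [div_eq_inv_mul]

theorem expMap_eq_sum {N : Module.End ℝ V} {x : V} {k : ℕ} (h : (N ^ (k + 1)) x = 0) (t : ℝ) :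
    expMap N t x = ∑ n ∈ Finset.range (k + 1), (t ^ n / n.factorial) • (N ^ n) x := by
  refine (expMap_hasSum N t x).unique (hasSum_sum_of_ne_finset_zero fun n hn => ?_)
  rw [Finset.mem_range, not_lt] at hn
  have : (N ^ n) x = 0 := by
    rw [← Nat.sub_add_cancel hn, pow_add, Module.End.mul_apply, h, map_zero]
  rw [this, smul_zero]

/-- On `x` the exponential is a polynomial in `t`, and the scaling isolates its coefficient of
degree `k`. -/
theorem tendsto_expMap_nilpotent {N : Module.End ℝ V} {x : V} {k : ℕ}
    (h : (N ^ (k + 1)) x = 0) :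
    Tendsto (fun t : ℝ => ((k.factorial : ℝ) / t ^ k) • expMap N t x) atTop (𝓝 ((N ^ k) x)) := by
  simp_rw [expMap_eq_sum h, Finset.sum_range_succ, smul_add, Finset.smul_sum, smul_smul]
  have h1 : Tendsto (fun t : ℝ => ∑ n ∈ Finset.range k,
      ((k.factorial : ℝ) / t ^ k * (t ^ n / n.factorial)) • (N ^ n) x) atTop (𝓝 0) := by
    rw [← Finset.sum_const_zero (s := Finset.range k) (M := V)]
    refine tendsto_finsetSum _ fun n hn => ?_
    rw [Finset.mem_range] at hn
    rw [← zero_smul ℝ ((N ^ n) x)]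
    refine Tendsto.smul_const ?_ _
    have h2 : Tendsto (fun t : ℝ => ((k.factorial : ℝ) / n.factorial) * (t ^ (k - n))⁻¹) atTop
        (𝓝 (((k.factorial : ℝ) / n.factorial) * 0)) :=
      (tendsto_inv_atTop_zero.comp (tendsto_pow_atTop (by omega))).const_mul _
    rw [mul_zero] at h2
    refine h2.congr' ((eventually_gt_atTop 0).mono fun t ht => ?_)
    have : t ^ k = t ^ (k - n) * t ^ n := by rw [← pow_add, Nat.sub_add_cancel hn.le]
    beta_reduce
    rw [this]
    field_simp
  have h3 : Tendsto (fun t : ℝ => ((k.factorial : ℝ) / t ^ k * (t ^ k / k.factorial)) • (N ^ k) x)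
      atTop (𝓝 ((N ^ k) x)) := by
    refine tendsto_const_nhds.congr' ((eventually_gt_atTop 0).mono fun t ht => ?_)
    have : (k.factorial : ℝ) ≠ 0 := by exact_mod_cast k.factorial_ne_zero
    beta_reduce
    rw [div_mul_div_cancel₀ (by positivity), div_self this, one_smul]
  simpa using h1.add h3

theorem expMap_add_of_commute {S N : Module.End ℝ V} (h : Commute S N) (t : ℝ) :
    expMap (S + N) t = expMap S t * expMap N t := by
  have := FiniteDimensional.complete ℝ V
  let : NormedAlgebra ℚ (V →L[ℝ] V) := NormedAlgebra.restrictScalars ℚ ℝ (V →L[ℝ] V)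
  unfold expMap
  rw [map_add, smul_add]
  refine NormedSpace.exp_add_of_commute (Commute.smul_left (Commute.smul_right ?_ t) t)
  ext x
  exact LinearMap.congr_fun h.eq x

theorem expMap_apply_comm {S N : Module.End ℝ V} (h : Commute S N) (t : ℝ) (x : V) :
    N (expMap S t x) = expMap S t (N x) := by
  refine ((expMap_hasSum S t x).map N N.continuous_of_finiteDimensional).unique ?_
  convert expMap_hasSum S t (N x) using 1
  funext n
  simp only [Function.comp, map_smul]
  congr 1
  exact (LinearMap.congr_fun (h.pow_left n).eq x).symm

namespace IsBoundedNilpotentSplit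

variable {A S N : Module.End ℝ V}

/-- The operators `exp (tS)`, for `t` of either sign, stay in a compact ball, so they converge along
any ultrafilter; the limits of `exp (tS)` and `exp (-tS)` are inverse to each other. -/
theorem exists_tendsto (hA : IsBoundedNilpotentSplit A S N) (F : Ultrafilter ℝ) :
    ∃ g g' : V →L[ℝ] V, Tendsto (expMap S) F (𝓝 g) ∧
      Tendsto (fun t => expMap S (-t)) F (𝓝 g') ∧ g * g' = 1 ∧ g' * g = 1 ∧
      ∀ x, N (g x) = g (N x) := by
  have := FiniteDimensional.proper ℝ (V →L[ℝ] V)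
  obtain ⟨C, hC⟩ := hA.bounded
  have key : ∀ f : ℝ → V →L[ℝ] V, (∀ t, ‖f t‖ ≤ C) → ∃ g, Tendsto f F (𝓝 g) := fun f hf => by
    obtain ⟨g, -, hg⟩ := (isCompact_closedBall (0 : V →L[ℝ] V) C).ultrafilter_le_nhds' (F.map f)
      (Filter.mem_map.2 (Filter.Eventually.of_forall fun t => by simpa using hf t))
    exact ⟨g, hg⟩
  obtain ⟨g, hg⟩ := key _ hC
  obtain ⟨g', hg'⟩ := key (fun t => expMap S (-t)) fun t => hC _
  refine ⟨g, g', hg, hg', ?_, ?_, fun x => ?_⟩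
  · refine tendsto_nhds_unique (hg.mul hg') (tendsto_const_nhds.congr fun t => ?_)
    rw [← expMap_add, add_neg_cancel, expMap_zero]
  · refine tendsto_nhds_unique (hg'.mul hg) (tendsto_const_nhds.congr fun t => ?_)
    rw [← expMap_add, neg_add_cancel, expMap_zero]
  · refine tendsto_nhds_unique
      ((N.continuous_of_finiteDimensional.tendsto _).comp (tendsto_clm_apply hg tendsto_const_nhds))
      ((tendsto_clm_apply hg tendsto_const_nhds).congr fun t => ?_)
    exact (expMap_apply_comm hA.comm t x).symm

/-- Recurrence of a bounded group: if `exp (tS)` tends to `g` along an ultrafilter at infinity, then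
`exp ((t - s)S)` is close to `g * g⁻¹ = 1` for suitable `s` and then `t` much larger than `s`. -/
theorem exists_tendsto_one (hA : IsBoundedNilpotentSplit A S N) :
    ∃ F : Ultrafilter ℝ, (F : Filter ℝ) ≤ atTop ∧ Tendsto (expMap S) F (𝓝 1) := by
  rw [← mapClusterPt_iff_ultrafilter, mapClusterPt_iff_frequently]
  intro W hW
  obtain ⟨U, hU⟩ := Ultrafilter.exists_le (atTop : Filter ℝ)
  obtain ⟨g, g', hg, hg', hgg', -, -⟩ := hA.exists_tendsto U
  have h1 : ∀ᶠ p in (U : Filter ℝ) ×ˢ (U : Filter ℝ), expMap S (-p.1) ∈ (fun _ => Set.univ) p →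
      expMap S p.2 * expMap S (-p.1) ∈ W := by
    have : Tendsto (fun p : ℝ × ℝ => expMap S p.2 * expMap S (-p.1))
        ((U : Filter ℝ) ×ˢ (U : Filter ℝ)) (𝓝 1) := by
      rw [← hgg']
      exact (hg.comp tendsto_snd).mul (hg'.comp tendsto_fst)
    exact (this.eventually hW).mono fun _ h _ => h
  rw [frequently_atTop]
  intro T
  obtain ⟨s, hs⟩ := h1.curry.exists
  obtain ⟨t, ht, htT⟩ := (hs.and (hU (eventually_ge_atTop (s + T)))).exists
  refine ⟨t - s, by linarith, ?_⟩
  rw [sub_eq_add_neg, expMap_add]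
  exact ht trivial

theorem exists_pow_apply_ne_zero (hA : IsBoundedNilpotentSplit A S N) {x : V} (hx : x ≠ 0) :
    ∃ k, (N ^ k) x ≠ 0 ∧ (N ^ (k + 1)) x = 0 := by
  classical
  have hex : ∃ n, (N ^ n) x = 0 := let ⟨n, hn⟩ := hA.nilpotent; ⟨n, by simp [hn]⟩
  have h0 : Nat.find hex ≠ 0 := fun h => hx (by simpa [h] using Nat.find_spec hex)
  refine ⟨Nat.find hex - 1, Nat.find_min hex (by omega), ?_⟩
  rw [Nat.sub_add_cancel (by omega)]
  exact Nat.find_spec hex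

theorem tendsto_projFlow (hA : IsBoundedNilpotentSplit A S N) {F : Ultrafilter ℝ}
    (hF : (F : Filter ℝ) ≤ atTop) {g : V →L[ℝ] V} (hg : Tendsto (expMap S) F (𝓝 g)) {x : V}
    (hx : x ≠ 0) {k : ℕ} (hk : (N ^ (k + 1)) x = 0) (hgk : g ((N ^ k) x) ≠ 0) :
    Tendsto (fun t => projFlow A t (Projectivization.mk ℝ x hx)) F
      (𝓝 (Projectivization.mk ℝ _ hgk)) := by
  simp_rw [projFlow_mk]
  refine tendsto_mk_of_smul (c := fun t => (k.factorial : ℝ) / t ^ k) _ ?_ _ ?_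
  · exact hF ((eventually_gt_atTop 0).mono fun t ht => by positivity)
  · refine (tendsto_clm_apply hg ((tendsto_expMap_nilpotent hk).mono_left hF)).congr fun t => ?_
    rw [map_smul, hA.add_eq, expMap_add_of_commute hA.comm]
    rfl

/-- A limit point of the orbit of `x` is spanned by `g (N ^ k x)`, with `g` commuting with `N`, so
it lies in `ker N`. On `ker N` itself the flow is that of `S`, which returns close to the identity.
-/
theorem mapClusterPt_iff (hA : IsBoundedNilpotentSplit A S N) (p : ℙ ℝ V) :
    (MapClusterPt p atTop fun t => projFlow A t p) ↔ p ∈ projSet (chainEnds N 0) := by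
  induction p using Projectivization.ind with
  | h x hx =>
    rw [mk_mem_projSet, mapClusterPt_iff_ultrafilter]
    have h0 : x ∈ chainEnds N 0 ↔ N x = 0 := by
      simp [chainEnds, Module.End.one_eq_id]
    rw [h0]
    constructor
    · rintro ⟨F, hF, hlim⟩
      obtain ⟨g, g', hg, -, -, hg'g, hgN⟩ := hA.exists_tendsto F
      obtain ⟨k, hk, hk1⟩ := hA.exists_pow_apply_ne_zero hx
      have hgk : g ((N ^ k) x) ≠ 0 := fun h => hk (by
        have := congrArg (fun f : V →L[ℝ] V => f ((N ^ k) x)) hg'g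
        simpa [h] using this.symm)
      have := tendsto_nhds_unique hlim (hA.tendsto_projFlow hF hg hx hk1 hgk)
      obtain ⟨a, ha⟩ := (Projectivization.mk_eq_mk_iff' ℝ _ _ _ _).1 this
      rw [← ha, map_smul, hgN, ← Module.End.mul_apply, ← pow_succ', hk1, map_zero, smul_zero]
    · intro hN
      obtain ⟨F, hF, h1⟩ := hA.exists_tendsto_one
      exact ⟨F, hF, hA.tendsto_projFlow (k := 0) hF h1 hx (by simpa using hN) (by simpa using hx)⟩

/-- Along a time ultrafilter with `exp (tS) → 1` the two limits are spanned by the last nonzero `N ^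
k x` and by `y`. Conversely, along any ultrafilter the limits are spanned by `g (N ^ k x)` and `g
y`, which are proportional. -/
theorem asymptotic_iff (hA : IsBoundedNilpotentSplit A S N) {x y : V} (hx : x ≠ 0) (hy : y ≠ 0)
    (hN : N y = 0) :
    Asymptotic (projFlow A) (Projectivization.mk ℝ x hx) (Projectivization.mk ℝ y hy) ↔
      ∃ (k : ℕ) (c : ℝ), c ≠ 0 ∧ (N ^ k) x = c • y := by
  constructor
  · intro h
    obtain ⟨F, hF, h1⟩ := hA.exists_tendsto_one
    obtain ⟨k, hk, hk1⟩ := hA.exists_pow_apply_ne_zero hx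
    have := h F hF _ _ (hA.tendsto_projFlow hF h1 hx hk1 hk)
      (hA.tendsto_projFlow (k := 0) hF h1 hy (by simpa using hN) (by simpa using hy))
    obtain ⟨a, ha⟩ := (Projectivization.mk_eq_mk_iff' ℝ _ _ _ _).1 this
    have ha' : a • y = (N ^ k) x := ha
    exact ⟨k, a, fun h0 => hk (by rw [← ha', h0, zero_smul]), ha'.symm⟩
  · rintro ⟨k, c, hc, hk⟩ F hF a b ha hb
    obtain ⟨g, g', hg, -, -, hg'g, hgN⟩ := hA.exists_tendsto F
    have hgy : g y ≠ 0 := fun h => hy (by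
      have := congrArg (fun f : V →L[ℝ] V => f y) hg'g
      simpa [h] using this.symm)
    have h1 := tendsto_nhds_unique ha (hA.tendsto_projFlow (k := k) hF hg hx
      (by rw [pow_succ', Module.End.mul_apply, hk, map_smul, hN, smul_zero])
      (by rw [hk, map_smul]; exact smul_ne_zero hc hgy))
    have h2 := tendsto_nhds_unique hb (hA.tendsto_projFlow (k := 0) hF hg hy (by simpa using hN)
      hgy)
    rw [h1, h2]
    exact (Projectivization.mk_eq_mk_iff' ℝ _ _ _ _).2 ⟨c, by rw [hk, map_smul]; rfl⟩

/-- If `y = N ^ (j + 1) x`, the class of `y` contains the affine space `x + ker (N ^ (j + 1))`, of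
dimension at least `dim ker (N ^ j) + 1` since `chainEnds N j` contains `y ≠ 0`. Otherwise only
exponents `k ≤ j` occur and the class lies in the projective space of the preimage of `span {y}`
under `N ^ j`, which is one dimension too small. -/
theorem mem_projSet_chainEnds_succ_iff (hA : IsBoundedNilpotentSplit A S N) {j : ℕ} {p : ℙ ℝ V}
    (hp : p ∈ projSet (chainEnds N j)) :
    p ∈ projSet (chainEnds N (j + 1)) ↔
      ContainsEuclidean (finrank ℝ (LinearMap.ker (N ^ j)) + 1)
        {q | Asymptotic (projFlow A) q p} := by
  induction p using Projectivization.ind with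
  | h y hy =>
    rw [mk_mem_projSet] at hp ⊢
    have hN : N y = 0 := hp.1
    constructor
    · rintro ⟨-, x, hx⟩
      refine containsEuclidean_of_affine (W := LinearMap.ker (N ^ (j + 1))) (x₀ := x)
        (fun h => hy (hx.symm.trans h)) ?_ fun z hz h => ?_
      · rw [finrank_ker_pow_succ, add_comm]
        refine Nat.add_le_add_right ?_ _
        exact Submodule.one_le_finrank_iff.2 fun h => hy (by rw [h] at hp; simpa using hp)
      · refine (hA.asymptotic_iff h hy hN).2 ⟨j + 1, 1, one_ne_zero, ?_⟩
        rw [map_add, hx, LinearMap.mem_ker.1 hz, add_zero, one_smul]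
    · intro h
      by_contra hnot
      have hnot' : ∀ x, (N ^ (j + 1)) x ≠ y := fun x hx => hnot ⟨hN, x, hx⟩
      have hsub : ContainsEuclidean (finrank ℝ (LinearMap.ker (N ^ j)) + 1)
          (projSet ((Submodule.span ℝ {y}).comap (N ^ j))) := by
        refine h.mono fun q hq => ?_
        induction q using Projectivization.ind with
        | h x hx =>
          rw [mk_mem_projSet, Submodule.mem_comap]
          obtain ⟨k, c, hc, hk⟩ := (hA.asymptotic_iff hx hy hN).1 hq
          -- A larger exponent would exhibit `y` as a value of `N ^ (j + 1)`.
          have hkj : k ≤ j := by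
            by_contra! hlt
            refine hnot' (c⁻¹ • (N ^ (k - (j + 1))) x) ?_
            rw [map_smul, ← Module.End.mul_apply, ← pow_add, Nat.add_sub_cancel' hlt, hk,
              inv_smul_smul₀ hc]
          rw [← Nat.sub_add_cancel hkj, pow_add, Module.End.mul_apply, hk, map_smul]
          refine Submodule.smul_mem _ _ ?_
          rcases Nat.eq_zero_or_pos (j - k) with h0 | h0
          · rw [h0]; exact Submodule.mem_span_singleton_self y
          · rw [← Nat.sub_add_cancel h0, pow_add, Module.End.mul_apply, pow_one, hN, map_zero]
            exact Submodule.zero_mem _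
      have hlt := hsub.lt_finrank
      obtain ⟨-, x, hx⟩ := hp
      have hle : (Submodule.span ℝ {y}).comap (N ^ j) ≤
          LinearMap.ker (N ^ j) ⊔ Submodule.span ℝ {x} := fun z hz => by
        obtain ⟨a, ha⟩ := Submodule.mem_span_singleton.1 hz
        have : z = (z - a • x) + a • x := by abel
        rw [this]
        refine add_mem (Submodule.mem_sup_left ?_) (Submodule.mem_sup_right
          (Submodule.smul_mem _ _ (Submodule.mem_span_singleton_self x)))
        rw [LinearMap.mem_ker, map_sub, map_smul, hx, ha, sub_self]
      have h2 := (Submodule.finrank_mono hle).trans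
        (Submodule.finrank_add_le_finrank_add_finrank _ _)
      have hx0 : x ≠ 0 := fun h0 => hy (by rw [← hx, h0, map_zero])
      rw [finrank_span_singleton hx0] at h2
      omega

end IsBoundedNilpotentSplit

/-- The Jordan structures of the nilpotent parts of conjugate projective flows coincide. -/
theorem finrank_chainEnds_eq {A S N A' S' N' : Module.End ℝ V}
    (hA : IsBoundedNilpotentSplit A S N) (hA' : IsBoundedNilpotentSplit A' S' N')
    (hconj : TopConjugate (projFlow A) (projFlow A')) (j : ℕ) :
    finrank ℝ (chainEnds N j) = finrank ℝ (chainEnds N' j) := by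
  obtain ⟨h, hc⟩ := hconj
  have hdim : ∀ j, (∀ p, p ∈ projSet (chainEnds N j) ↔ h p ∈ projSet (chainEnds N' j)) →
      finrank ℝ (chainEnds N j) = finrank ℝ (chainEnds N' j) := fun j hj =>
    le_antisymm (finrank_le_of_homeomorph h fun p => (hj p).1)
      (finrank_le_of_homeomorph h.symm fun p hp => (hj _).2 (by simpa using hp))
  -- Equality of the kernel dimensions is carried through the induction because the characterization
  -- of the next chain ends refers to it.
  have key : ∀ j, finrank ℝ (LinearMap.ker (N ^ j)) = finrank ℝ (LinearMap.ker (N' ^ j)) ∧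
      ∀ p, p ∈ projSet (chainEnds N j) ↔ h p ∈ projSet (chainEnds N' j) := by
    intro j
    induction j with
    | zero =>
      refine ⟨by rw [pow_zero, pow_zero], fun p => ?_⟩
      rw [← hA.mapClusterPt_iff, ← hA'.mapClusterPt_iff]
      refine ⟨mapClusterPt_flow_homeomorph h hc, fun hp => ?_⟩
      simpa using mapClusterPt_flow_homeomorph h.symm (conj_symm hc) hp
    | succ j ih =>
      obtain ⟨ih1, ih2⟩ := ih
      refine ⟨by rw [finrank_ker_pow_succ, finrank_ker_pow_succ, ih1, hdim j ih2], fun p => ?_⟩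
      have hmono : ∀ (M : Module.End ℝ V) (q : ℙ ℝ V), q ∈ projSet (chainEnds M (j + 1)) →
          q ∈ projSet (chainEnds M j) := fun M q hq => by
        refine le_trans (show q.submodule ≤ _ from hq) (inf_le_inf_left _ ?_)
        rintro _ ⟨x, rfl⟩
        exact ⟨M x, by rw [pow_succ, Module.End.mul_apply]⟩
      by_cases hp : p ∈ projSet (chainEnds N j)
      · rw [hA.mem_projSet_chainEnds_succ_iff hp,
          hA'.mem_projSet_chainEnds_succ_iff ((ih2 p).1 hp), ih1]
        refine ⟨fun he => he.homeomorph h fun q hq => hq.homeomorph h hc,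
          fun he => he.homeomorph h.symm fun q hq => ?_⟩
        simpa using Asymptotic.homeomorph h.symm (conj_symm hc) hq
      · exact iff_of_false (fun h1 => hp (hmono _ _ h1))
          fun h1 => hp ((ih2 p).2 (hmono _ _ h1))
  exact hdim j (key j).2

end Core

/-! ### Jordan chains -/

section Chains

open Module

theorem map_chainPred {M M' F : Type*} [Zero M] [Zero M'] [FunLike F M M'] [ZeroHomClass F M M']
    (f : F) {n : ℕ} (e : Fin n → M) (j : Fin n) : f (chainPred e j) = chainPred (f ∘ e) j := by
  unfold chainPred
  split_ifs
  · exact map_zero f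
  · rfl

theorem pow_apply_chain {K M : Type*} [Field K] [AddCommGroup M] [Module K M] {N : Module.End K M}
    {s : ℕ} {e : Fin s → M} (h : ∀ j, N (e j) = chainPred e j) (k : ℕ) (j : Fin s) :
    (N ^ k) (e j) = if k ≤ j.val then e ⟨j.val - k, by omega⟩ else 0 := by
  induction k with
  | zero => simp
  | succ k ih =>
    rw [pow_succ', Module.End.mul_apply, ih]
    rcases lt_trichotomy k j.val with hk | hk | hk
    · rw [if_pos hk.le, if_pos (by omega), h, chainPred, if_neg (by simp; omega)]
      congr 1
    · rw [if_pos hk.le, if_neg (by omega), h, chainPred, if_pos (by simp; omega)]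
    · rw [if_neg (by omega), if_neg (by omega), map_zero]

/-- The power `N ^ n` kills the first `n` vectors but sends the last one to the nonzero start of the
chain. -/
theorem linearIndependent_of_chain {K M : Type*} [Field K] [AddCommGroup M] [Module K M]
    {N : Module.End K M} {s : ℕ} {e : Fin s → M} (h : ∀ j, N (e j) = chainPred e j)
    (h0 : ∀ hs : 0 < s, e ⟨0, hs⟩ ≠ 0) : LinearIndependent K e := by
  induction s with
  | zero => exact linearIndependent_empty_type
  | succ n ih =>
    rw [linearIndependent_finSucc']
    constructor
    · refine ih (fun j => ?_) fun hs => h0 _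
      rw [Fin.init, h]
      rfl
    · intro hmem
      have hle : Submodule.span K (Set.range (Fin.init e : Fin n → M)) ≤ LinearMap.ker (N ^ n) := by
        rw [Submodule.span_le]
        rintro _ ⟨j, rfl⟩
        have hj : ¬ n ≤ (Fin.castSucc j).val := by simp
        change (N ^ n) (e (Fin.castSucc j)) = 0
        rw [pow_apply_chain h, if_neg hj]
      have h1 := LinearMap.mem_ker.1 (hle hmem)
      rw [pow_apply_chain h, if_pos (by simp)] at h1
      refine h0 n.succ_pos ?_
      rw [← h1]
      congr 1
      simp

theorem exists_linearMap_of_linearIndependent {K ι M M' : Type*} [Field K] [AddCommGroup M]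
    [Module K M] [AddCommGroup M'] [Module K M'] {e : ι → M} (he : LinearIndependent K e)
    (w : ι → M') : ∃ f : M →ₗ[K] M', ∀ i, f (e i) = w i := by
  obtain ⟨f, hf⟩ := LinearMap.exists_extend ((Basis.span he).constr K w)
  refine ⟨f, fun i => ?_⟩
  have h1 := LinearMap.congr_fun hf (Basis.span he i)
  rw [Basis.constr_basis] at h1
  rw [← h1, LinearMap.comp_apply, Submodule.subtype_apply, Basis.span_apply]

variable {V : Type*} [AddCommGroup V] [Module ℝ V]

/-- A vector in the span of independent chains of length `s` which is killed by the shift is the end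
of a chain of length `s`. -/
theorem exists_pow_eq_of_chains {κ : Type*} {s : ℕ} {e : κ → Fin s → V}
    (he : LinearIndependent ℝ fun p : κ × Fin s => e p.1 p.2) {N : Module.End ℝ V}
    (hN : ∀ c j, N (e c j) = chainPred (e c) j) {x : V}
    (hx : x ∈ Submodule.span ℝ (Set.range fun p : κ × Fin s => e p.1 p.2)) (hNx : N x = 0) :
    ∃ y ∈ Submodule.span ℝ (Set.range fun p : κ × Fin s => e p.1 p.2), (N ^ (s - 1)) y = x := by
  set W := Submodule.span ℝ (Set.range fun p : κ × Fin s => e p.1 p.2)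
  -- `L` shifts each chain upwards, against `N`. Then `1 - L * N` kills all chain vectors but the
  -- first ones, which are values of `N ^ (s - 1)`, and it fixes `x` because `N x = 0`.
  obtain ⟨L, hL⟩ := exists_linearMap_of_linearIndependent he fun p : κ × Fin s =>
    if h : p.2.val + 1 < s then e p.1 ⟨p.2.val + 1, h⟩ else 0
  have hL' (c : κ) (j : Fin s) : L (e c j) = if h : j.val + 1 < s then e c ⟨j.val + 1, h⟩ else 0 :=
    hL (c, j)
  have key : W ≤ (W.map (N ^ (s - 1))).comap (1 - L * N) := by
    rw [Submodule.span_le]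
    rintro _ ⟨⟨c, j⟩, rfl⟩
    change e c j - L (N (e c j)) ∈ W.map (N ^ (s - 1))
    rw [hN, chainPred]
    have hj := j.isLt
    by_cases h0 : j.val = 0
    · rw [if_pos h0, map_zero, sub_zero]
      refine ⟨e c ⟨s - 1, by omega⟩, Submodule.subset_span ⟨(c, ⟨s - 1, by omega⟩), rfl⟩, ?_⟩
      rw [pow_apply_chain (hN c), if_pos le_rfl]
      congr 1
      ext
      simp [h0]
    · rw [if_neg h0, hL', dif_pos (by simp; omega)]
      have : (⟨j.val - 1 + 1, by omega⟩ : Fin s) = j := by ext; simp; omega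
      simp [this]
  obtain ⟨y, hy, hyx⟩ := key hx
  refine ⟨y, hy, hyx.trans ?_⟩
  change x - L (N x) = x
  rw [hNx, map_zero, sub_zero]

theorem chain_mem_span {κ : Type*} {s : ℕ} {e : κ → Fin s → V} (c : κ) (j : Fin s) :
    e c j ∈ Submodule.span ℝ (Set.range fun p : κ × Fin s => e p.1 p.2) :=
  Submodule.subset_span ⟨(c, j), rfl⟩

theorem chainPred_mem_span {κ : Type*} {s : ℕ} {e : κ → Fin s → V} (c : κ) (j : Fin s) :
    chainPred (e c) j ∈ Submodule.span ℝ (Set.range fun p : κ × Fin s => e p.1 p.2) := by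
  unfold chainPred
  split_ifs
  · exact Submodule.zero_mem _
  · exact chain_mem_span _ _

/-- `S` is zero on a block with eigenvalue `0` and otherwise the rotation `u ↦ ω v`, `v ↦ -ω u`;
what remains of `A` shifts the chains. -/
theorem IsRealJordanSubspace.exists_split {A : Module.End ℝ V} {ω : ℝ} {s : ℕ} {W : Submodule ℝ V}
    (h : IsRealJordanSubspace A ω s W) : ∃ S : Module.End ℝ V, ∀ x ∈ W,
      S x ∈ W ∧ (A - S) x ∈ W ∧ S ((A - S) x) = (A - S) (S x) ∧ S (S x) = -(ω ^ 2 • x) ∧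
      (ω = 0 → S x = 0) ∧ ((A - S) ^ s) x = 0 ∧
      ((A - S) x = 0 → ∃ y ∈ W, ((A - S) ^ (s - 1)) y = x) := by
  rcases h with ⟨rfl, e, he, rfl, hA⟩ | ⟨hω, u, v, he, rfl, hA⟩
  · refine ⟨0, fun x hx => ?_⟩
    have hA0 : A - 0 = A := sub_zero A
    have hr : Set.range e = Set.range fun p : Unit × Fin s => (fun _ => e) p.1 p.2 := by
      ext y; simp
    have he' : LinearIndependent ℝ fun p : Unit × Fin s => (fun _ : Unit => e) p.1 p.2 :=
      he.comp (fun p : Unit × Fin s => p.2) fun p q h => Prod.ext rfl h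
    rw [hA0]
    refine ⟨by simp, ?_, by simp, by simp, by simp, ?_, fun hx0 => ?_⟩
    · have : Submodule.span ℝ (Set.range e) ≤ (Submodule.span ℝ (Set.range e)).comap A := by
        rw [Submodule.span_le]
        rintro _ ⟨j, rfl⟩
        change A (e j) ∈ Submodule.span ℝ (Set.range e)
        rw [hA, hr]
        exact chainPred_mem_span (e := fun _ : Unit => e) () j
      exact this hx
    · have : Submodule.span ℝ (Set.range e) ≤ LinearMap.ker (A ^ s) := by
        rw [Submodule.span_le]
        rintro _ ⟨j, rfl⟩
        change (A ^ s) (e j) = 0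
        rw [pow_apply_chain hA, if_neg (by omega)]
      exact this hx
    · rw [hr] at hx ⊢
      exact exists_pow_eq_of_chains he' (fun _ => hA) hx hx0
  · obtain ⟨S, hS⟩ := exists_linearMap_of_linearIndependent he
      (Sum.elim (fun j => ω • v j) fun j => -(ω • u j))
    have hSu (j : Fin s) : S (u j) = ω • v j := hS (Sum.inl j)
    have hSv (j : Fin s) : S (v j) = -(ω • u j) := hS (Sum.inr j)
    let e : Bool → Fin s → V := fun b => bif b then v else u
    have hfun : (fun p : Bool × Fin s => e p.1 p.2) = Sum.elim u v ∘ Equiv.boolProdEquivSum _ := by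
      funext ⟨b, j⟩
      cases b <;> rfl
    have hr : Set.range (Sum.elim u v) = Set.range fun p : Bool × Fin s => e p.1 p.2 := by
      rw [hfun, EquivLike.range_comp]
    have he' : LinearIndependent ℝ fun p : Bool × Fin s => e p.1 p.2 := by
      rw [hfun]
      exact he.comp _ (Equiv.injective _)
    have hNu (j : Fin s) : (A - S) (u j) = chainPred u j := by
      rw [LinearMap.sub_apply, (hA j).1, hSu, add_sub_cancel_left]
    have hNv (j : Fin s) : (A - S) (v j) = chainPred v j := by
      rw [LinearMap.sub_apply, (hA j).2, hSv, add_sub_cancel_left]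
    have hN : ∀ c j, (A - S) (e c j) = chainPred (e c) j := by
      rintro (_ | _)
      · exact hNu
      · exact hNv
    have hcomm (j : Fin s) : S (chainPred u j) = (A - S) (ω • v j) := by
      rw [map_chainPred, map_smul, hNv]
      unfold chainPred
      split_ifs
      · rw [smul_zero]
      · exact hSu _
    have hcomm' (j : Fin s) : S (chainPred v j) = (A - S) (-(ω • u j)) := by
      rw [map_chainPred, map_neg, map_smul, hNu]
      unfold chainPred
      split_ifs
      · rw [smul_zero, neg_zero]
      · exact hSv _
    refine ⟨S, fun x hx => ?_⟩
    rw [hr] at hx ⊢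
    set W := Submodule.span ℝ (Set.range fun p : Bool × Fin s => e p.1 p.2)
    have hle (P : Submodule ℝ V) (hu : ∀ j, u j ∈ P) (hv : ∀ j, v j ∈ P) : x ∈ P := by
      have : W ≤ P := by
        rw [Submodule.span_le]
        rintro _ ⟨⟨_ | _, j⟩, rfl⟩
        · exact hu j
        · exact hv j
      exact this hx
    have huW (j : Fin s) : u j ∈ W := chain_mem_span (e := e) false j
    have hvW (j : Fin s) : v j ∈ W := chain_mem_span (e := e) true j
    refine ⟨?_, ?_, ?_, ?_, fun h => absurd h hω, ?_, exists_pow_eq_of_chains he' hN hx⟩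
    · refine hle (W.comap S) (fun j => ?_) fun j => ?_
      · rw [Submodule.mem_comap, hSu]
        exact W.smul_mem _ (hvW j)
      · rw [Submodule.mem_comap, hSv]
        exact W.neg_mem (W.smul_mem _ (huW j))
    · refine hle (W.comap (A - S)) (fun j => ?_) fun j => ?_
      · rw [Submodule.mem_comap, hNu]
        exact chainPred_mem_span (e := e) false j
      · rw [Submodule.mem_comap, hNv]
        exact chainPred_mem_span (e := e) true j
    · refine hle (LinearMap.eqLocus (S ∘ₗ (A - S)) ((A - S) ∘ₗ S)) (fun j => ?_) fun j => ?_
      · rw [LinearMap.mem_eqLocus, LinearMap.comp_apply, LinearMap.comp_apply, hNu, hSu, hcomm]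
      · rw [LinearMap.mem_eqLocus, LinearMap.comp_apply, LinearMap.comp_apply, hNv, hSv, hcomm']
    · refine hle (LinearMap.eqLocus (S ∘ₗ S) (-(ω ^ 2 • LinearMap.id))) (fun j => ?_) fun j => ?_
      · rw [LinearMap.mem_eqLocus, LinearMap.comp_apply, hSu, map_smul, hSv, smul_neg, smul_smul,
          ← pow_two]
        rfl
      · rw [LinearMap.mem_eqLocus, LinearMap.comp_apply, hSv, map_neg, map_smul, hSu, smul_smul,
          ← pow_two]
        rfl
    · refine hle (LinearMap.ker ((A - S) ^ s)) (fun j => ?_) fun j => ?_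
      · rw [LinearMap.mem_ker, pow_apply_chain hNu, if_neg (by omega)]
      · rw [LinearMap.mem_ker, pow_apply_chain hNv, if_neg (by omega)]

end Chains

/-! ### The splitting defined by a real Jordan decomposition -/

namespace RealJordanDecomposition

open Module

variable {V : Type*} [AddCommGroup V] [Module ℝ V] {A : Module.End ℝ V}

theorem eq_of_eqOn_blocks (D : RealJordanDecomposition A) {M : Type*} [AddCommGroup M] [Module ℝ M]
    {f g : V →ₗ[ℝ] M} (h : ∀ i, ∀ x ∈ D.block i, f x = g x) : f = g := by
  have hle : (⨆ i, D.block i) ≤ LinearMap.eqLocus f g := iSup_le fun i x hx => h i x hx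
  rw [D.isInternal.submodule_iSup_eq_top] at hle
  ext x
  exact hle (Submodule.mem_top : x ∈ (⊤ : Submodule ℝ V))

/-- The linear map with given restrictions to the blocks. -/
noncomputable def glue (D : RealJordanDecomposition A) {M : Type*} [AddCommGroup M] [Module ℝ M]
    (f : Fin D.num → V →ₗ[ℝ] M) : V →ₗ[ℝ] M :=
  (DirectSum.toModule ℝ (Fin D.num) M fun i => f i ∘ₗ (D.block i).subtype) ∘ₗ
    (LinearEquiv.ofBijective (DirectSum.coeLinearMap D.block) D.isInternal).symm.toLinearMap

theorem glue_apply (D : RealJordanDecomposition A) {M : Type*} [AddCommGroup M] [Module ℝ M]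
    (f : Fin D.num → V →ₗ[ℝ] M) {i : Fin D.num} {x : V} (hx : x ∈ D.block i) :
    D.glue f x = f i x := by
  have h1 : (LinearEquiv.ofBijective (DirectSum.coeLinearMap D.block) D.isInternal).symm x =
      DirectSum.lof ℝ _ (fun i => D.block i) i ⟨x, hx⟩ := by
    rw [LinearEquiv.symm_apply_eq]
    exact (DirectSum.coeLinearMap_lof D.block i ⟨x, hx⟩).symm
  rw [glue, LinearMap.comp_apply, LinearEquiv.coe_coe, h1, DirectSum.toModule_lof]
  rfl

/-- The projection to a block. -/
noncomputable def proj (D : RealJordanDecomposition A) (i : Fin D.num) : Module.End ℝ V :=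
  D.glue fun j => if j = i then LinearMap.id else 0

theorem proj_of_mem (D : RealJordanDecomposition A) {i : Fin D.num} {x : V}
    (hx : x ∈ D.block i) : D.proj i x = x := by
  rw [proj, D.glue_apply _ hx, if_pos rfl, LinearMap.id_apply]

theorem proj_of_mem_of_ne (D : RealJordanDecomposition A) {i j : Fin D.num} (hij : j ≠ i) {x : V}
    (hx : x ∈ D.block j) : D.proj i x = 0 := by
  rw [proj, D.glue_apply _ hx, if_neg hij, LinearMap.zero_apply]

theorem proj_mem (D : RealJordanDecomposition A) (i : Fin D.num) (x : V) :
    D.proj i x ∈ D.block i := by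
  have hle : (⨆ j, D.block j) ≤ (D.block i).comap (D.proj i) := iSup_le fun j y hy => by
    rw [Submodule.mem_comap]
    by_cases hij : j = i
    · subst hij
      rwa [D.proj_of_mem hy]
    · rw [D.proj_of_mem_of_ne hij hy]
      exact Submodule.zero_mem _
  rw [D.isInternal.submodule_iSup_eq_top] at hle
  exact hle (Submodule.mem_top : x ∈ (⊤ : Submodule ℝ V))

theorem sum_proj (D : RealJordanDecomposition A) (x : V) : ∑ i, D.proj i x = x := by
  have : ∑ i, D.proj i = LinearMap.id := D.eq_of_eqOn_blocks fun j y hy => by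
    rw [LinearMap.sum_apply, Finset.sum_eq_single j fun i _ hi => D.proj_of_mem_of_ne hi.symm hy]
    · exact D.proj_of_mem hy
    · simp
  simpa using LinearMap.congr_fun this x

theorem proj_comm (D : RealJordanDecomposition A) {T : Module.End ℝ V}
    (hT : ∀ i, ∀ x ∈ D.block i, T x ∈ D.block i) (i : Fin D.num) (x : V) :
    D.proj i (T x) = T (D.proj i x) := by
  have : D.proj i ∘ₗ T = T ∘ₗ D.proj i := D.eq_of_eqOn_blocks fun j y hy => by
    rw [LinearMap.comp_apply, LinearMap.comp_apply]
    by_cases hij : j = i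
    · subst hij
      rw [D.proj_of_mem hy, D.proj_of_mem (hT _ y hy)]
    · rw [D.proj_of_mem_of_ne hij hy, D.proj_of_mem_of_ne hij (hT j y hy), map_zero]
  exact LinearMap.congr_fun this x

theorem proj_of_mem_J (D : RealJordanDecomposition A) {s : ℕ} {x : V} (hx : x ∈ D.J s)
    {i : Fin D.num} (hi : D.size i ≠ s) : D.proj i x = 0 := by
  have : D.J s ≤ LinearMap.ker (D.proj i) := iSup₂_le fun j hj y hy =>
    D.proj_of_mem_of_ne (by rintro rfl; exact hi hj) hy
  exact this hx

/-- `S` and `N` are the semisimple and the nilpotent part of `A` with respect to the decomposition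
`D`. -/
structure IsSplit (D : RealJordanDecomposition A) (S N : Module.End ℝ V) : Prop where
  S_mem : ∀ i, ∀ x ∈ D.block i, S x ∈ D.block i
  N_mem : ∀ i, ∀ x ∈ D.block i, N x ∈ D.block i
  add_eq : A = S + N
  comm : Commute S N
  sq : ∀ i, ∀ x ∈ D.block i, S (S x) = -(D.freq i ^ 2 • x)
  S_eq_zero : ∀ i, D.freq i = 0 → ∀ x ∈ D.block i, S x = 0
  pow_size : ∀ i, ∀ x ∈ D.block i, (N ^ D.size i) x = 0
  exists_pow_eq : ∀ i, ∀ x ∈ D.block i, N x = 0 → ∃ y, (N ^ (D.size i - 1)) y = x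

theorem exists_isSplit (D : RealJordanDecomposition A) : ∃ S N, D.IsSplit S N := by
  choose S hS using fun i => (D.isJordan i).exists_split
  let T : Module.End ℝ V := D.glue S
  have hT (i : Fin D.num) (x : V) (hx : x ∈ D.block i) : T x = S i x := D.glue_apply S hx
  have hN (i : Fin D.num) (x : V) (hx : x ∈ D.block i) : (A - T) x = (A - S i) x := by
    rw [LinearMap.sub_apply, LinearMap.sub_apply, hT i x hx]
  have hmem (i : Fin D.num) (x : V) (hx : x ∈ D.block i) : (A - T) x ∈ D.block i := by
    rw [hN i x hx]; exact (hS i x hx).2.1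
  have hpow (i : Fin D.num) (x : V) (hx : x ∈ D.block i) (k : ℕ) :
      ((A - T) ^ k) x = ((A - S i) ^ k) x := by
    induction k generalizing x with
    | zero => rfl
    | succ k ih =>
      rw [pow_succ, pow_succ, Module.End.mul_apply, Module.End.mul_apply, ih _ (hmem i x hx),
        hN i x hx]
  have hTmem (i : Fin D.num) (x : V) (hx : x ∈ D.block i) : T x ∈ D.block i := by
    rw [hT i x hx]; exact (hS i x hx).1
  refine ⟨T, A - T, hTmem, hmem, (add_sub_cancel _ _).symm,
    D.eq_of_eqOn_blocks fun i x hx => ?_, fun i x hx => ?_, fun i hi x hx => ?_,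
    fun i x hx => ?_, fun i x hx h0 => ?_⟩
  · change T ((A - T) x) = (A - T) (T x)
    rw [hT i _ (hmem i x hx), hN i x hx, hN i _ (hTmem i x hx), hT i x hx]
    exact (hS i x hx).2.2.1
  · rw [hT i _ (hTmem i x hx), hT i x hx]
    exact (hS i x hx).2.2.2.1
  · rw [hT i x hx]
    exact (hS i x hx).2.2.2.2.1 hi
  · rw [hpow i x hx]
    exact (hS i x hx).2.2.2.2.2.1
  · rw [hN i x hx] at h0
    obtain ⟨y, hy, hyx⟩ := (hS i x hx).2.2.2.2.2.2 h0
    exact ⟨y, by rw [hpow i y hy, hyx]⟩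

end RealJordanDecomposition

/-! ### Real and imaginary parts in the complexification -/

section Complexification

variable {V : Type*} [AddCommGroup V] [Module ℝ V]

theorem exists_eq_tmul_add_tmul (y : ℂ ⊗[ℝ] V) :
    ∃ a b : V, y = (1 : ℂ) ⊗ₜ[ℝ] a + Complex.I ⊗ₜ[ℝ] b := by
  induction y using TensorProduct.induction_on with
  | zero => exact ⟨0, 0, by simp⟩
  | tmul z v =>
    refine ⟨z.re • v, z.im • v, ?_⟩
    rw [← TensorProduct.smul_tmul, ← TensorProduct.smul_tmul, ← TensorProduct.add_tmul]
    congr 1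
    apply Complex.ext <;> simp
  | add y z hy hz =>
    obtain ⟨a, b, rfl⟩ := hy
    obtain ⟨c, d, rfl⟩ := hz
    exact ⟨a + c, b + d, by rw [TensorProduct.tmul_add, TensorProduct.tmul_add]; abel⟩

theorem tmul_add_tmul_eq_zero_iff {a b : V} :
    (1 : ℂ) ⊗ₜ[ℝ] a + Complex.I ⊗ₜ[ℝ] b = 0 ↔ a = 0 ∧ b = 0 := by
  constructor
  · intro h
    have key : ∀ f : ℂ →ₗ[ℝ] ℝ, f 1 • a + f Complex.I • b = 0 := fun f => by
      have := congrArg (TensorProduct.lid ℝ V ∘ f.rTensor V) h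
      simpa using this
    exact ⟨by simpa using key Complex.reLm, by simpa using key Complex.imLm⟩
  · rintro ⟨rfl, rfl⟩
    simp

theorem complexify_tmul (A : Module.End ℝ V) (z : ℂ) (v : V) :
    complexify A (z ⊗ₜ[ℝ] v) = z ⊗ₜ[ℝ] A v := rfl

theorem complexify_pow_apply (A : Module.End ℝ V) (k : ℕ) (a b : V) :
    (complexify A ^ k) ((1 : ℂ) ⊗ₜ[ℝ] a + Complex.I ⊗ₜ[ℝ] b) =
      (1 : ℂ) ⊗ₜ[ℝ] (A ^ k) a + Complex.I ⊗ₜ[ℝ] (A ^ k) b := by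
  induction k generalizing a b with
  | zero => rfl
  | succ k ih =>
    rw [pow_succ, pow_succ, Module.End.mul_apply, map_add, complexify_tmul, complexify_tmul, ih]
    rfl

theorem smul_tmul_complex (z w : ℂ) (v : V) : z • (w ⊗ₜ[ℝ] v) = (z * w) ⊗ₜ[ℝ] v := by
  rw [TensorProduct.smul_tmul', smul_eq_mul]

theorem one_tmul_smul (r : ℝ) (v : V) :
    (1 : ℂ) ⊗ₜ[ℝ] (r • v) = (r : ℂ) • ((1 : ℂ) ⊗ₜ[ℝ] v) := by
  rw [smul_tmul_complex, ← TensorProduct.smul_tmul]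
  congr 1

/-- Both eigenvalues `± iω` have square `-ω ^ 2`. For `ω = 0` this only gives `A (A x) = 0`, hence
the separate second clause; together the two clauses describe the real eigenspace without
complexification. -/
theorem apply_apply_of_mem_realEigenspace {A : Module.End ℝ V} {ω : ℝ} {x : V}
    (hx : x ∈ realEigenspace A ω) : A (A x) = -(ω ^ 2 • x) ∧ (ω = 0 → A x = 0) := by
  have hx0 : (1 : ℂ) ⊗ₜ[ℝ] x ∈ (complexify A).eigenspace (Complex.I * ω) ⊔
      (complexify A).eigenspace (-(Complex.I * ω)) := hx
  obtain ⟨y, hy, z, hz, hyz⟩ := Submodule.mem_sup.1 hx0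
  rw [Module.End.mem_eigenspace_iff] at hy hz
  have hx' : (1 : ℂ) ⊗ₜ[ℝ] x = y + z := hyz.symm
  constructor
  · have h1 : complexify A (complexify A ((1 : ℂ) ⊗ₜ[ℝ] x)) =
        -(((ω : ℂ) ^ 2) • ((1 : ℂ) ⊗ₜ[ℝ] x)) := by
      rw [hx', map_add, hy, hz, map_add, map_smul, map_smul, hy, hz, smul_smul, smul_smul,
        neg_mul_neg, ← smul_add, ← neg_smul]
      congr 1
      linear_combination (ω : ℂ) ^ 2 * Complex.I_sq
    rw [complexify_tmul, complexify_tmul] at h1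
    have h2 := one_tmul_smul (ω ^ 2) x
    push_cast at h2
    have h3 : (1 : ℂ) ⊗ₜ[ℝ] (A (A x) + ω ^ 2 • x) + Complex.I ⊗ₜ[ℝ] (0 : V) = 0 := by
      rw [TensorProduct.tmul_zero, add_zero, TensorProduct.tmul_add, h1, h2, neg_add_cancel]
    exact eq_neg_of_add_eq_zero_left (tmul_add_tmul_eq_zero_iff.1 h3).1
  · rintro rfl
    have h1 : complexify A ((1 : ℂ) ⊗ₜ[ℝ] x) = 0 := by
      rw [hx', map_add, hy, hz]
      simp
    have h3 : (1 : ℂ) ⊗ₜ[ℝ] (A x) + Complex.I ⊗ₜ[ℝ] (0 : V) = 0 := by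
      rw [TensorProduct.tmul_zero, add_zero]
      exact h1
    exact (tmul_add_tmul_eq_zero_iff.1 h3).1

theorem mem_realEigenspace {A : Module.End ℝ V} {ω : ℝ} {x : V} (h : A (A x) = -(ω ^ 2 • x))
    (h0 : ω = 0 → A x = 0) : x ∈ realEigenspace A ω := by
  rw [realEigenspace, Submodule.mem_comap]
  by_cases hω : ω = 0
  · refine Submodule.mem_sup_left ?_
    rw [Module.End.mem_eigenspace_iff, hω]
    change complexify A ((1 : ℂ) ⊗ₜ[ℝ] x) = _ • _
    rw [complexify_tmul, h0 hω]
    simp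
  · have hω' : (ω : ℂ) ≠ 0 := by exact_mod_cast hω
    -- For `c = ± i` these vectors are, up to the factor `1/2`, the components of `x` in the two
    -- eigenspaces.
    have key : ∀ c : ℂ, c ^ 2 = -1 → (1 : ℂ) ⊗ₜ[ℝ] x - (c / ω) ⊗ₜ[ℝ] A x ∈
        (complexify A).eigenspace (c * ω) := fun c hc => by
      rw [Module.End.mem_eigenspace_iff, map_sub, complexify_tmul, complexify_tmul, h, smul_sub,
        smul_tmul_complex, smul_tmul_complex, TensorProduct.tmul_neg, sub_neg_eq_add,
        ← TensorProduct.smul_tmul]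
      have e1 : ω ^ 2 • (c / ω) = c * ω * 1 := by
        rw [Algebra.smul_def]
        simp only [Complex.coe_algebraMap]
        push_cast
        field_simp
      have e2 : c * ω * (c / ω) = -1 := by
        rw [← hc]
        field_simp
      rw [e1, e2, TensorProduct.neg_tmul]
      abel
    have hsum : (1 : ℂ) ⊗ₜ[ℝ] x = (1 / 2 : ℂ) • ((1 : ℂ) ⊗ₜ[ℝ] x - (Complex.I / ω) ⊗ₜ[ℝ] A x) +
        (1 / 2 : ℂ) • ((1 : ℂ) ⊗ₜ[ℝ] x - (-Complex.I / ω) ⊗ₜ[ℝ] A x) := by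
      rw [← smul_add, neg_div, TensorProduct.neg_tmul, sub_neg_eq_add, sub_add_add_cancel,
        ← two_smul ℂ, smul_smul]
      norm_num
    change (1 : ℂ) ⊗ₜ[ℝ] x ∈ (complexify A).eigenspace (Complex.I * ω) ⊔
      (complexify A).eigenspace (-(Complex.I * ω))
    rw [hsum]
    refine Submodule.add_mem_sup (Submodule.smul_mem _ _ (key _ Complex.I_sq))
      (Submodule.smul_mem _ _ ?_)
    rw [← neg_mul]
    exact key _ (by rw [neg_sq, Complex.I_sq])

/-- If the complexification has a Jordan subspace of size `s` for the eigenvalue `iω`, then so has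
the real operator whose zero set is the corresponding real eigenspace. -/
theorem exists_pow_apply_of_isComplexJordanSubspace {A : Module.End ℝ V} {z : ℂ} {s : ℕ}
    {W : Submodule ℂ (ℂ ⊗[ℝ] V)} (h : IsComplexJordanSubspace A z (s + 1) W)
    (hA : EigenvaluesImaginary A) :
    ∃ (ω : ℝ) (x : V), (ω = 0 ∧ (A ^ (s + 1)) x = 0 ∧ (A ^ s) x ≠ 0) ∨
      (ω ≠ 0 ∧ ((A * A + ω ^ 2 • 1) ^ (s + 1)) x = 0 ∧ ((A * A + ω ^ 2 • 1) ^ s) x ≠ 0) := by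
  obtain ⟨e, he, -, hAe⟩ := h
  set M : Module.End ℂ (ℂ ⊗[ℝ] V) := complexify A - z • 1 with hM
  have hMe : ∀ j, M (e j) = chainPred e j := fun j => by
    simp [hM, hAe]
  have he0 : e 0 ≠ 0 := he.ne_zero 0
  have hz : z.re = 0 := hA z (Module.End.hasEigenvalue_of_hasEigenvector (x := e 0)
    ⟨Module.End.mem_eigenspace_iff.2 (by rw [hAe]; simp [chainPred]), he0⟩)
  have hlast : (M ^ s) (e (Fin.last s)) = e 0 := by
    rw [pow_apply_chain hMe, if_pos (by simp)]
    congr 1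
    ext
    simp
  have hlast' : (M ^ (s + 1)) (e (Fin.last s)) = 0 := by
    rw [pow_apply_chain hMe, if_neg (by simp)]
  have hreal : ∀ T : Module.End ℝ V, (complexify T ^ (s + 1)) (e (Fin.last s)) = 0 →
      (complexify T ^ s) (e (Fin.last s)) ≠ 0 → ∃ x, (T ^ (s + 1)) x = 0 ∧ (T ^ s) x ≠ 0 := by
    intro T h1 h2
    obtain ⟨a, b, hab⟩ := exists_eq_tmul_add_tmul (e (Fin.last s))
    rw [hab, complexify_pow_apply] at h1 h2
    obtain ⟨ha, hb⟩ := tmul_add_tmul_eq_zero_iff.1 h1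
    rw [Ne, tmul_add_tmul_eq_zero_iff, not_and_or] at h2
    rcases h2 with h2 | h2
    · exact ⟨a, ha, h2⟩
    · exact ⟨b, hb, h2⟩
  have hzI : z = Complex.I * z.im := by apply Complex.ext <;> simp [hz]
  refine ⟨z.im, ?_⟩
  by_cases h0 : z.im = 0
  · have hz0 : z = 0 := Complex.ext hz h0
    have hMA : M = complexify A := by rw [hM, hz0, zero_smul, sub_zero]
    obtain ⟨x, hx⟩ := hreal A (by rw [← hMA, hlast']) (by rw [← hMA, hlast]; exact he0)
    exact ⟨x, Or.inl ⟨h0, hx⟩⟩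
  -- With `z = iω` the real operator `A² + ω²` factors as `(A + z)(A - z)`. The second factor shifts
  -- the chain, and the first multiplies its initial vector by `2z ≠ 0`.
  · have hT : complexify (A * A + z.im ^ 2 • 1) = (complexify A + z • 1) * M := by
      have h2 : ((z.im : ℂ) ^ 2) = -(z * z) := by
        rw [hzI]
        simp only [Complex.mul_im, Complex.I_re, Complex.I_im, Complex.ofReal_re,
          Complex.ofReal_im]
        push_cast
        linear_combination (z.im : ℂ) ^ 2 * Complex.I_sq
      refine TensorProduct.AlgebraTensorModule.curry_injective (LinearMap.ext_ring
        (LinearMap.ext fun v => ?_))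
      change (1 : ℂ) ⊗ₜ[ℝ] (A (A v) + z.im ^ 2 • v) =
        complexify A (complexify A ((1 : ℂ) ⊗ₜ[ℝ] v) - z • ((1 : ℂ) ⊗ₜ[ℝ] v)) +
          z • (complexify A ((1 : ℂ) ⊗ₜ[ℝ] v) - z • ((1 : ℂ) ⊗ₜ[ℝ] v))
      rw [TensorProduct.tmul_add, one_tmul_smul, Complex.ofReal_pow, h2, map_sub, map_smul,
        complexify_tmul, complexify_tmul, smul_sub, smul_smul, neg_smul]
      abel
    have hcomm : Commute (complexify A + z • 1) M := by
      have h1 : Commute (complexify A) (z • 1) := (Commute.one_right _).smul_right z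
      rw [hM]
      exact ((Commute.refl _).sub_right h1).add_left (h1.symm.sub_right (Commute.refl _))
    have hpow (k : ℕ) : (complexify (A * A + z.im ^ 2 • 1) ^ k) (e (Fin.last s)) =
        ((complexify A + z • 1) ^ k) ((M ^ k) (e (Fin.last s))) := by
      rw [hT, hcomm.mul_pow, Module.End.mul_apply]
    have hplus (k : ℕ) : ((complexify A + z • 1) ^ k) (e 0) = (2 * z) ^ k • e 0 := by
      induction k with
      | zero => simp
      | succ k ih =>
        have h1 : (complexify A + z • 1) (e 0) = (2 * z) • e 0 := by
          rw [LinearMap.add_apply, hAe, chainPred, if_pos (by simp), add_zero,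
            LinearMap.smul_apply, Module.End.one_apply, ← add_smul, two_mul]
        rw [pow_succ', Module.End.mul_apply, ih, map_smul, h1, smul_smul, ← pow_succ]
    have hz0 : z ≠ 0 := fun h => h0 (by rw [h]; rfl)
    obtain ⟨x, hx⟩ := hreal (A * A + z.im ^ 2 • 1) (by rw [hpow, hlast', map_zero])
      (by rw [hpow, hlast, hplus]; exact smul_ne_zero (pow_ne_zero _ (by simpa using hz0)) he0)
    exact ⟨x, Or.inr ⟨h0, hx⟩⟩

/-- A real Jordan subspace contains the real part of complex Jordan subspaces of smaller size. -/
theorem IsRealJordanSubspace.exists_isComplexJordanSubspace {A : Module.End ℝ V} {ω : ℝ} {n : ℕ}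
    {U : Submodule ℝ V} (h : IsRealJordanSubspace A ω n U) {s : ℕ} (hs : s ≤ n) :
    ∃ z W, IsComplexJordanSubspace A z s W := by
  have key : ∀ (z : ℂ) (e : Fin n → ℂ ⊗[ℝ] V),
      (∀ j, complexify A (e j) = z • e j + chainPred e j) → (∀ hn : 0 < n, e ⟨0, hn⟩ ≠ 0) →
      ∃ z W, IsComplexJordanSubspace A z s W := by
    intro z e he h0
    have he' : ∀ j : Fin s, complexify A ((e ∘ Fin.castLE hs) j) =
        z • (e ∘ Fin.castLE hs) j + chainPred (e ∘ Fin.castLE hs) j := fun j => he _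
    refine ⟨z, _, e ∘ Fin.castLE hs,
      linearIndependent_of_chain (N := complexify A - z • 1) (fun j => ?_)
        (fun h => h0 (h.trans_le hs)), rfl, he'⟩
    rw [LinearMap.sub_apply, he']
    simp
  rcases h with ⟨-, e, hli, -, he⟩ | ⟨-, u, v, hli, -, he⟩
  · refine key 0 (fun j => (1 : ℂ) ⊗ₜ[ℝ] e j) (fun j => ?_) fun hn h0 => ?_
    · rw [complexify_tmul, he, zero_smul, zero_add]
      exact map_chainPred (TensorProduct.mk ℝ ℂ V 1) e j
    · have : (1 : ℂ) ⊗ₜ[ℝ] e ⟨0, hn⟩ + Complex.I ⊗ₜ[ℝ] (0 : V) = 0 := by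
        rw [TensorProduct.tmul_zero, add_zero]
        exact h0
      exact hli.ne_zero _ (tmul_add_tmul_eq_zero_iff.1 this).1
  -- The vectors `u - iv` form a complex chain for `iω`.
  · refine key (Complex.I * ω) (fun j => (1 : ℂ) ⊗ₜ[ℝ] u j + Complex.I ⊗ₜ[ℝ] (-v j))
      (fun j => ?_) fun hn h0 => ?_
    · have h1 : chainPred (fun j => (1 : ℂ) ⊗ₜ[ℝ] u j + Complex.I ⊗ₜ[ℝ] (-v j)) j =
          (1 : ℂ) ⊗ₜ[ℝ] chainPred u j + Complex.I ⊗ₜ[ℝ] (-chainPred v j) := by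
        unfold chainPred
        split_ifs <;> simp
      rw [h1, map_add, complexify_tmul, complexify_tmul, map_neg, (he j).1, (he j).2, smul_add,
        smul_tmul_complex, smul_tmul_complex]
      have e1 : (Complex.I * ω * 1) ⊗ₜ[ℝ] u j = Complex.I ⊗ₜ[ℝ] (ω • u j) := by
        rw [← TensorProduct.smul_tmul]
        congr 1
        simp [Algebra.smul_def, mul_comm]
      have e2 : (Complex.I * ω * Complex.I) ⊗ₜ[ℝ] (-v j) = (1 : ℂ) ⊗ₜ[ℝ] (ω • v j) := by
        rw [← TensorProduct.smul_tmul, TensorProduct.tmul_neg, ← TensorProduct.neg_tmul]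
        congr 1
        rw [Algebra.smul_def, Complex.coe_algebraMap, mul_one]
        linear_combination (-(ω : ℂ)) * Complex.I_sq
      rw [e1, e2]
      simp only [TensorProduct.tmul_add, neg_add, neg_neg]
      abel
    · exact hli.ne_zero (Sum.inl _) (tmul_add_tmul_eq_zero_iff.1 h0).1

end Complexification

/-! ### Jordan invariants in terms of the nilpotent part -/

/-- Iterating gives `x = M ^ n (N ^ n x)`, so a fixed vector of `M * N` vanishes once `N ^ n` kills
it. -/
theorem eq_zero_of_eq_pow_apply {V : Type*} [AddCommGroup V] [Module ℝ V] {M N : Module.End ℝ V}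
    (hM : Commute M N) {n : ℕ} {x : V} (hn : (N ^ n) x = 0) (hx : x = M (N x)) : x = 0 := by
  have : ∀ k, x = (M ^ k) ((N ^ k) x) := by
    intro k
    induction k with
    | zero => rfl
    | succ k ih =>
      rw [← Module.End.mul_apply, ← hM.mul_pow, pow_succ, Module.End.mul_apply,
        Module.End.mul_apply, ← hx, hM.mul_pow, Module.End.mul_apply, ← ih]
  rw [this n, hn, map_zero]

namespace RealJordanDecomposition.IsSplit

open Module

section Algebra

variable {V : Type*} [AddCommGroup V] [Module ℝ V] {A S N : Module.End ℝ V}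
  {D : RealJordanDecomposition A}

theorem pow_mem (h : D.IsSplit S N) (k : ℕ) {i : Fin D.num} {x : V} (hx : x ∈ D.block i) :
    (N ^ k) x ∈ D.block i := by
  induction k with
  | zero => exact hx
  | succ k ih =>
    rw [pow_succ', Module.End.mul_apply]
    exact h.N_mem i _ ih

theorem pow_apply_eq_zero (h : D.IsSplit S N) {i : Fin D.num} {x : V} (hx : x ∈ D.block i) {k : ℕ}
    (hk : D.size i ≤ k) : (N ^ k) x = 0 := by
  rw [← Nat.sub_add_cancel hk, pow_add, Module.End.mul_apply, h.pow_size i x hx, map_zero]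

theorem isNilpotent (h : D.IsSplit S N) : IsNilpotent N :=
  ⟨∑ i, D.size i, D.eq_of_eqOn_blocks fun i _ hx => h.pow_apply_eq_zero hx
    (Finset.single_le_sum (f := D.size) (fun _ _ => Nat.zero_le _) (Finset.mem_univ i))⟩

theorem A_apply (h : D.IsSplit S N) (x : V) : A x = S x + N x :=
  LinearMap.congr_fun h.add_eq x

theorem A_mem (h : D.IsSplit S N) {i : Fin D.num} {x : V} (hx : x ∈ D.block i) :
    A x ∈ D.block i := by
  rw [h.A_apply]
  exact (D.block i).add_mem (h.S_mem i x hx) (h.N_mem i x hx)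

theorem A_A_apply (h : D.IsSplit S N) {i : Fin D.num} {x : V} (hx : x ∈ D.block i) :
    A (A x) = -(D.freq i ^ 2 • x) + ((2 : ℝ) • S + N) (N x) := by
  have hc : S (N x) = N (S x) := LinearMap.congr_fun h.comm.eq x
  rw [h.A_apply, h.A_apply]
  simp only [LinearMap.add_apply, map_add, h.sq i x hx, hc, two_smul]
  abel

theorem commute_two_smul_add (h : D.IsSplit S N) : Commute ((2 : ℝ) • S + N) N :=
  (h.comm.smul_left 2).add_left (Commute.refl N)

theorem eq_zero_of_sq_ne (h : D.IsSplit S N) {i : Fin D.num} {x : V} (hx : x ∈ D.block i) {ω : ℝ}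
    (hω : ω ^ 2 ≠ D.freq i ^ 2) (hA : A (A x) = -(ω ^ 2 • x)) : x = 0 := by
  refine eq_zero_of_eq_pow_apply (M := (D.freq i ^ 2 - ω ^ 2)⁻¹ • ((2 : ℝ) • S + N))
    (h.commute_two_smul_add.smul_left _) (h.pow_size i x hx) ?_
  have h1 : ((2 : ℝ) • S + N) (N x) = (D.freq i ^ 2 - ω ^ 2) • x := by
    rw [h.A_A_apply hx] at hA
    rw [sub_smul, ← sub_eq_zero, ← sub_eq_zero.2 hA]
    abel
  rw [LinearMap.smul_apply, h1, inv_smul_smul₀ (sub_ne_zero.2 hω.symm)]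

/-- On a block of frequency `f`, `A² = -f² + (2S + N)N`. If `ω² = f² ≠ 0`, then `(2S + N)(N x) = 0`;
applying `S` turns this into `N x = (2f²)⁻¹ S N (N x)`, which nilpotency excludes unless `N x = 0`.
For `f = 0` the map `A` is `N`, and for `ω² ≠ f²` the vector itself is zero. -/
theorem N_apply_eq_zero (h : D.IsSplit S N) {i : Fin D.num} {x : V} (hx : x ∈ D.block i) {ω : ℝ}
    (hA : A (A x) = -(ω ^ 2 • x)) (h0 : ω = 0 → A x = 0) : N x = 0 := by
  by_cases hω : ω ^ 2 = D.freq i ^ 2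
  · by_cases hf : D.freq i = 0
    · have hω0 : ω = 0 := by simpa [hf] using hω
      have := h0 hω0
      rwa [h.A_apply, h.S_eq_zero i hf x hx, zero_add] at this
    · have hNx := h.N_mem i x hx
      refine eq_zero_of_eq_pow_apply (M := (2 * D.freq i ^ 2)⁻¹ • S)
        (h.comm.smul_left _) (h.pow_size i _ hNx) ?_
      have h1 : ((2 : ℝ) • S + N) (N x) = 0 := by
        rw [h.A_A_apply hx, hω] at hA
        exact left_eq_add.1 hA.symm
      have h2 := congrArg S h1
      rw [LinearMap.add_apply, LinearMap.smul_apply, map_add, map_smul, h.sq i _ hNx,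
        map_zero] at h2
      have h3 : S (N (N x)) = (2 * D.freq i ^ 2) • N x := by
        rw [← sub_eq_zero, ← h2, mul_smul, smul_neg]
        abel
      rw [LinearMap.smul_apply, h3, inv_smul_smul₀]
      positivity
  · rw [h.eq_zero_of_sq_ne hx hω hA, map_zero]

/-- The sum of the intersections of `ker N` with the blocks whose index satisfies `P`. -/
def _root_.ProjFlow.RealJordanDecomposition.kerSum (D : RealJordanDecomposition A)
    (N : Module.End ℝ V) (P : Fin D.num → Prop) : Submodule ℝ V :=
  ⨆ (i : Fin D.num) (_ : P i), LinearMap.ker N ⊓ D.block i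

theorem mem_kerSum {P : Fin D.num → Prop} {x : V} (h1 : ∀ i, N (D.proj i x) = 0)
    (h2 : ∀ i, ¬ P i → D.proj i x = 0) : x ∈ D.kerSum N P := by
  rw [← D.sum_proj x]
  refine Submodule.sum_mem _ fun i _ => ?_
  by_cases hi : P i
  · exact Submodule.mem_iSup_of_mem i (Submodule.mem_iSup_of_mem hi ⟨h1 i, D.proj_mem i x⟩)
  · rw [h2 i hi]
    exact Submodule.zero_mem _

/-- The projections to the blocks commute with `N`. In a block of size `n` the power `N ^ j`
vanishes if `n ≤ j`, while for `n > j` each vector of the kernel is an `N ^ (n - 1)`-value, hence an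
`N ^ j`-value. -/
theorem chainEnds_eq (h : D.IsSplit S N) (j : ℕ) :
    chainEnds N j = D.kerSum N fun i => j < D.size i := by
  apply le_antisymm
  · rintro x ⟨hx, y, rfl⟩
    refine mem_kerSum (fun i => ?_) fun i hi => ?_
    · rw [← D.proj_comm h.N_mem, LinearMap.mem_ker.1 hx, map_zero]
    · rw [D.proj_comm fun i x hx => h.pow_mem j hx]
      exact h.pow_apply_eq_zero (D.proj_mem i y) (not_lt.1 hi)
  · refine iSup₂_le fun i hi x hx => ⟨hx.1, ?_⟩
    obtain ⟨y, rfl⟩ := h.exists_pow_eq i x hx.2 hx.1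
    refine ⟨(N ^ (D.size i - 1 - j)) y, ?_⟩
    rw [← Module.End.mul_apply, ← pow_add]
    congr 2
    omega

/-- Block components of a real eigenvector satisfy the same equations and are therefore killed by
`N`; conversely, on `ker N` in a block `A` acts as `S`, so these vectors are real eigenvectors for
the frequency of the block. -/
theorem iSup_realEigenspace_inf_J (h : D.IsSplit S N) (s : ℕ) :
    ⨆ ω : ℝ, realEigenspace A ω ⊓ D.J s = D.kerSum N fun i => D.size i = s := by
  apply le_antisymm
  · refine iSup_le fun ω x hx => ?_
    obtain ⟨h1, h2⟩ := apply_apply_of_mem_realEigenspace hx.1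
    have hA (i : Fin D.num) (x : V) : D.proj i (A x) = A (D.proj i x) :=
      D.proj_comm (fun i x hx => h.A_mem hx) i x
    refine mem_kerSum (fun i => ?_) fun i hi => D.proj_of_mem_J hx.2 hi
    refine h.N_apply_eq_zero (D.proj_mem i x) (ω := ω) ?_ fun h0 => ?_
    · rw [← hA, ← hA, h1, map_neg, map_smul]
    · rw [← hA, h2 h0, map_zero]
  · refine iSup₂_le fun i hi x hx => Submodule.mem_iSup_of_mem (D.freq i) ⟨?_, ?_⟩
    · have hN : N x = 0 := hx.1
      refine mem_realEigenspace ?_ fun h0 => ?_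
      · rw [h.A_A_apply hx.2, hN, map_zero, add_zero]
      · rw [h.A_apply, h.S_eq_zero i h0 x hx.2, hN, add_zero]
    · exact Submodule.mem_iSup_of_mem i (Submodule.mem_iSup_of_mem hi hx.2)

theorem finrank_chainEnds [FiniteDimensional ℝ V] (h : D.IsSplit S N) (s : ℕ) :
    finrank ℝ (chainEnds N s) = D.d (s + 1) + finrank ℝ (chainEnds N (s + 1)) := by
  rw [d, h.iSup_realEigenspace_inf_J, h.chainEnds_eq, h.chainEnds_eq]
  have hsup : D.kerSum N (fun i => s < D.size i) =
      D.kerSum N (fun i => D.size i = s + 1) ⊔ D.kerSum N (fun i => s + 1 < D.size i) := by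
    unfold kerSum
    rw [← iSup_sup_eq]
    refine iSup_congr fun i => ?_
    exact (iSup_congr_Prop (q := D.size i = s + 1 ∨ s + 1 < D.size i) (by omega)
      fun _ => rfl).trans iSup_or
  have hdisj : Disjoint (D.kerSum N fun i => D.size i = s + 1)
      (D.kerSum N fun i => s + 1 < D.size i) := by
    have := D.isInternal.submodule_iSupIndep.disjoint_biSup_biSup
      (s := {i | D.size i = s + 1}) (t := {i | s + 1 < D.size i})
      (Set.disjoint_left.2 fun i (h1 : D.size i = s + 1) (h2 : s + 1 < D.size i) => by omega)
    exact this.mono (iSup₂_mono fun _ _ => inf_le_right) (iSup₂_mono fun _ _ => inf_le_right)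
  have := Submodule.finrank_sup_add_finrank_inf_eq (D.kerSum N fun i => D.size i = s + 1)
    (D.kerSum N fun i => s + 1 < D.size i)
  rw [hdisj.eq_bot, finrank_bot, add_zero] at this
  rw [hsup, this]

theorem exists_isComplexJordanSubspace_iff (h : D.IsSplit S N) (hA : EigenvaluesImaginary A)
    (s : ℕ) : (∃ z W, IsComplexJordanSubspace A z (s + 1) W) ↔ chainEnds N s ≠ ⊥ := by
  constructor
  · rintro ⟨z, W, hW⟩
    obtain ⟨ω, x, hx⟩ := exists_pow_apply_of_isComplexJordanSubspace hW hA
    have key : ∃ w, (N ^ s) w ≠ 0 := by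
      by_contra! hN
      -- On each block `T` is either injective or a multiple `M * N` with `M` commuting with `N`. In
      -- the latter case `T ^ s = M ^ s * N ^ s` there, so `N ^ s = 0` rules out a chain of `T` of
      -- length `s + 1`.
      have main : ∀ T : Module.End ℝ V, (∀ i, ∀ y ∈ D.block i, T y ∈ D.block i) →
          (∀ i, (∀ y ∈ D.block i, T y = 0 → y = 0) ∨ ∃ M, Commute M N ∧
            ∀ y ∈ D.block i, T y = M (N y)) → (T ^ (s + 1)) x = 0 → (T ^ s) x = 0 := by
        intro T hT hi h0
        have hTpow (k : ℕ) : ∀ i, ∀ y ∈ D.block i, (T ^ k) y ∈ D.block i := by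
          induction k with
          | zero => exact fun _ _ hy => hy
          | succ k ih =>
            intro i y hy
            rw [pow_succ', Module.End.mul_apply]
            exact hT i _ (ih i y hy)
        rw [← D.sum_proj x, map_sum]
        refine Finset.sum_eq_zero fun i _ => ?_
        rcases hi i with hinj | ⟨M, hM, hMN⟩
        · refine hinj _ (hTpow s i _ (D.proj_mem i x)) ?_
          rw [← Module.End.mul_apply, ← pow_succ', ← D.proj_comm (hTpow _), h0, map_zero]
        · have hMk : ∀ k, ∀ y ∈ D.block i, (T ^ k) y = (M ^ k) ((N ^ k) y) := by
            intro k
            induction k with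
            | zero => exact fun _ _ => rfl
            | succ k ih =>
              intro y hy
              rw [pow_succ', Module.End.mul_apply, hMN _ (hTpow k i y hy), ih y hy,
                ← Module.End.mul_apply, ← Module.End.mul_apply, ← Module.End.mul_apply,
                ← Module.End.mul_apply]
              congr 1
              rw [pow_succ' M, pow_succ' N]
              simp only [mul_assoc]
              congr 1
              rw [← mul_assoc, ← (hM.pow_left k).eq, mul_assoc]
          rw [hMk s _ (D.proj_mem i x), hN, map_zero]
      rcases hx with ⟨-, h1, h2⟩ | ⟨hω, h1, h2⟩
      · refine h2 (main A (fun i y hy => h.A_mem hy) (fun i => ?_) h1)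
        by_cases hf : D.freq i = 0
        · refine Or.inr ⟨1, Commute.one_left _, fun y hy => ?_⟩
          rw [h.A_apply, h.S_eq_zero i hf y hy, zero_add]
          rfl
        · refine Or.inl fun y hy h0 => h.eq_zero_of_sq_ne hy (ω := 0) ?_ (by simp [h0])
          simpa using (pow_ne_zero 2 hf).symm
      · refine h2 (main _ (fun i y hy => ?_) (fun i => ?_) h1)
        · exact (D.block i).add_mem (h.A_mem (h.A_mem hy)) ((D.block i).smul_mem _ hy)
        · by_cases hf : ω ^ 2 = D.freq i ^ 2
          · refine Or.inr ⟨_, h.commute_two_smul_add, fun y hy => ?_⟩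
            change A (A y) + ω ^ 2 • y = _
            rw [h.A_A_apply hy, hf, add_right_comm, neg_add_cancel, zero_add]
          · exact Or.inl fun y hy h0 => h.eq_zero_of_sq_ne hy hf (eq_neg_of_add_eq_zero_left h0)
    obtain ⟨w, hw⟩ := key
    intro hbot
    classical
    have hex : ∃ n, (N ^ n) w = 0 := let ⟨n, hn⟩ := h.isNilpotent; ⟨n, by simp [hn]⟩
    -- The last nonzero power applied to `w` has exponent at least `s`, so it is a nonzero element
    -- of `chainEnds N s`.
    have hlt : s < Nat.find hex := by
      by_contra! hle
      apply hw
      rw [← Nat.sub_add_cancel hle, pow_add, Module.End.mul_apply, Nat.find_spec hex, map_zero]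
    have hne := Nat.find_min hex (m := Nat.find hex - 1) (by omega)
    apply hne
    rw [← Submodule.mem_bot ℝ, ← hbot]
    constructor
    · change N ((N ^ (Nat.find hex - 1)) w) = 0
      rw [← Module.End.mul_apply, ← pow_succ', Nat.sub_add_cancel (by omega)]
      exact Nat.find_spec hex
    · refine ⟨(N ^ (Nat.find hex - 1 - s)) w, ?_⟩
      rw [← Module.End.mul_apply, ← pow_add]
      congr 2
      omega
  · intro hne
    by_contra! hno
    apply hne
    rw [h.chainEnds_eq, eq_bot_iff]
    refine iSup₂_le fun i hi => ?_
    obtain ⟨z, W, hW⟩ := (D.isJordan i).exists_isComplexJordanSubspace (Nat.succ_le_of_lt hi)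
    exact absurd hW (hno z W)

end Algebra

/-! ### Boundedness of the flow of the semisimple part -/

section Bounded

variable {V : Type*} [NormedAddCommGroup V] [NormedSpace ℝ V] [FiniteDimensional ℝ V]
  {A S N : Module.End ℝ V} {D : RealJordanDecomposition A}

theorem _root_.ProjFlow.expMap_apply_of_sq {S : Module.End ℝ V} {ω : ℝ} (hω : ω ≠ 0) {x : V}
    (hx : S (S x) = -(ω ^ 2 • x)) (t : ℝ) :
    expMap S t x = Real.cos (ω * t) • x + (Real.sin (ω * t) / ω) • S x := by
  have heven (n : ℕ) : (S ^ (2 * n)) x = ((-1) ^ n * ω ^ (2 * n)) • x := by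
    induction n with
    | zero => simp
    | succ n ih =>
      rw [mul_add, pow_add, Module.End.mul_apply, mul_one, pow_two S, Module.End.mul_apply, hx,
        map_neg, map_smul, ih, smul_smul, ← neg_smul]
      congr 1
      ring
  refine (expMap_hasSum S t x).unique (HasSum.even_add_odd ?_ ?_)
  · have h1 := (Real.hasSum_cos (ω * t)).smul_const x
    convert h1 using 1
    funext n
    rw [heven, smul_smul]
    congr 1
    rw [mul_pow]
    ring
  · have h1 := ((Real.hasSum_sin (ω * t)).div_const ω).smul_const (S x)
    convert h1 using 1
    funext n
    rw [pow_succ' S, Module.End.mul_apply, heven, map_smul, smul_smul]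
    congr 1
    rw [mul_pow]
    field_simp
    ring

/-- Each orbit of `exp (tS)` is bounded, being a sum of block components that are constant or
trigonometric in `t`; Banach-Steinhaus makes the bound uniform. -/
theorem isBoundedNilpotentSplit (h : D.IsSplit S N) : IsBoundedNilpotentSplit A S N where
  add_eq := h.add_eq
  comm := h.comm
  nilpotent := h.isNilpotent
  bounded := by
    have := FiniteDimensional.complete ℝ V
    refine banach_steinhaus fun x => ?_
    have hi : ∀ i, ∀ y ∈ D.block i, ∃ C, ∀ t, ‖expMap S t y‖ ≤ C := by
      intro i y hy
      by_cases hf : D.freq i = 0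
      · refine ⟨‖y‖, fun t => le_of_eq ?_⟩
        rw [expMap_eq_sum (k := 0) (by simpa using h.S_eq_zero i hf y hy)]
        simp
      · refine ⟨‖y‖ + ‖(D.freq i)⁻¹ • S y‖, fun t => ?_⟩
        rw [expMap_apply_of_sq hf (h.sq i y hy), div_eq_mul_inv, mul_smul]
        refine (norm_add_le _ _).trans (add_le_add ?_ ?_)
        · rw [norm_smul]
          exact mul_le_of_le_one_left (norm_nonneg _) (Real.abs_cos_le_one _)
        · rw [norm_smul]
          exact mul_le_of_le_one_left (norm_nonneg _) (Real.abs_sin_le_one _)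
    choose C hC using fun i => hi i _ (D.proj_mem i x)
    refine ⟨∑ i, C i, fun t => ?_⟩
    conv_lhs => rw [← D.sum_proj x, map_sum]
    exact (norm_sum_le _ _).trans (Finset.sum_le_sum fun i _ => hC i t)

end Bounded

end RealJordanDecomposition.IsSplit

/-! ### Existence of real Jordan decompositions -/

section Existence

open Polynomial Module

variable {V : Type*} [AddCommGroup V] [Module ℝ V]

/-- The cyclic subspace generated by `w`. -/
noncomputable def cyclicSubspace (A : Module.End ℝ V) (w : V) : Submodule ℝ V :=
  LinearMap.range ((LinearMap.applyₗ w : Module.End ℝ V →ₗ[ℝ] V) ∘ₗ (aeval A).toLinearMap)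

theorem mem_cyclicSubspace {A : Module.End ℝ V} {w x : V} :
    x ∈ cyclicSubspace A w ↔ ∃ q : ℝ[X], aeval A q w = x := Iff.rfl

/-- The structure theorem for finitely generated torsion modules over `ℝ[X]`, applied to `V` with
`X` acting as `A`; `w i` is the vector that corresponds to the class of `1` in the `i`-th summand.
Exponents `0`, giving zero summands, are allowed. -/
theorem exists_cyclic_decomposition [FiniteDimensional ℝ V] (A : Module.End ℝ V) :
    ∃ (ι : Type) (_ : Fintype ι) (p : ι → ℝ[X]) (n : ι → ℕ) (w : ι → V),
      (∀ i, Irreducible (p i)) ∧ (∀ i q, aeval A q (w i) = 0 ↔ p i ^ n i ∣ q) ∧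
      iSupIndep (fun i => cyclicSubspace A (w i)) ∧ ⨆ i, cyclicSubspace A (w i) = ⊤ := by
  classical
  obtain ⟨ι, _, p, hp, n, ⟨E⟩⟩ := equiv_directSum_of_isTorsion (R := ℝ[X]) (M := AEval' A)
    (Module.AEval.isTorsion_of_finiteDimensional ℝ V A)
  let Q : ι → Type := fun i => ℝ[X] ⧸ Submodule.span ℝ[X] {p i ^ n i}
  let one : ∀ i, Q i := fun i => Submodule.Quotient.mk 1
  let w : ι → V := fun i => (AEval'.of A).symm (E.symm (DirectSum.lof ℝ[X] ι Q i (one i)))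
  have hE (q : ℝ[X]) (x : V) : E (AEval'.of A (aeval A q x)) = q • E (AEval'.of A x) := by
    rw [← map_smul]
    rfl
  have hw (i : ι) (q : ℝ[X]) : E (AEval'.of A (aeval A q (w i))) =
      DirectSum.lof ℝ[X] ι Q i (q • one i) := by
    rw [hE, map_smul]
    congr 1
    change E (AEval'.of A ((AEval'.of A).symm _)) = _
    rw [LinearEquiv.apply_symm_apply, LinearEquiv.apply_symm_apply]
  have hone (i : ι) (q : ℝ[X]) : q • one i = Submodule.Quotient.mk q := by
    change q • Submodule.Quotient.mk 1 = _
    rw [← Submodule.Quotient.mk_smul, smul_eq_mul, mul_one]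
  refine ⟨ι, inferInstance, p, n, w, hp, fun i q => ?_, ?_, ?_⟩
  · rw [← Ideal.mem_span_singleton, ← (AEval'.of A).map_eq_zero_iff, ← E.map_eq_zero_iff, hw, hone]
    have h1 := map_eq_zero_iff (DirectSum.lof ℝ[X] ι Q i) (DirectSum.of_injective (β := Q) i)
      (x := Submodule.Quotient.mk q)
    rw [h1]
    exact Submodule.Quotient.mk_eq_zero _
  · rw [iSupIndep_def]
    intro i
    rw [Submodule.disjoint_def]
    rintro _ ⟨q, rfl⟩ hx
    let c : V →+ Q i := (DFinsupp.evalAddMonoidHom (β := Q) i).comp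
      (E.toAddEquiv.toAddMonoidHom.comp (AEval'.of A).toAddEquiv.toAddMonoidHom)
    have hc (j : ι) (q : ℝ[X]) : c (aeval A q (w j)) = DirectSum.lof ℝ[X] ι Q j (q • one j) i := by
      rw [← hw]
      rfl
    have h0 : c (aeval A q (w i)) = 0 := by
      have : ∀ x ∈ ⨆ (j) (_ : j ≠ i), cyclicSubspace A (w j), c x = 0 := by
        intro x hx
        induction hx using Submodule.iSup_induction' with
        | mem j y hy =>
          by_cases hj : j = i
          · have : y = 0 := by simpa [hj] using hy
            rw [this, map_zero]
          · simp only [ne_eq, hj, not_false_eq_true, iSup_pos] at hy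
            obtain ⟨q, rfl⟩ := mem_cyclicSubspace.1 hy
            rw [hc]
            exact DFinsupp.single_eq_of_ne (Ne.symm hj)
        | zero => exact map_zero c
        | add x y _ _ hx hy => rw [map_add, hx, hy, add_zero]
      exact this _ hx
    rw [hc] at h0
    have h1 : q • one i = 0 := by
      rw [← h0]
      exact (DFinsupp.single_eq_same (i := i)).symm
    change aeval A q (w i) = 0
    rw [← (AEval'.of A).map_eq_zero_iff, ← E.map_eq_zero_iff, hw, h1, map_zero]
  · rw [eq_top_iff]
    intro x _
    have key : ∀ y : DirectSum ι Q, (AEval'.of A).symm (E.symm y) ∈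
        ⨆ i, cyclicSubspace A (w i) := by
      intro y
      induction y using DirectSum.induction_on with
      | zero => rw [map_zero, map_zero]; exact Submodule.zero_mem _
      | of i z =>
        obtain ⟨q, rfl⟩ := Submodule.Quotient.mk_surjective _ z
        refine Submodule.mem_iSup_of_mem i (mem_cyclicSubspace.2 ⟨q, ?_⟩)
        rw [LinearEquiv.eq_symm_apply, LinearEquiv.eq_symm_apply, hw, hone]
        rfl
      | add y z hy hz => rw [map_add, map_add]; exact Submodule.add_mem _ hy hz
    have := key (E (AEval'.of A x))
    rwa [E.symm_apply_apply, LinearEquiv.symm_apply_apply] at this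

/-- Applying `N` to a linear relation shortens all chains by one, so by induction only the
coefficients of the initial vectors survive. -/
theorem linearIndependent_of_chains {κ K M : Type*} [Fintype κ] [Field K] [AddCommGroup M]
    [Module K M] {N : Module.End K M} {s : ℕ} {e : κ → Fin s → M}
    (h : ∀ c j, N (e c j) = chainPred (e c) j)
    (h0 : ∀ hs : 0 < s, LinearIndependent K fun c => e c ⟨0, hs⟩) :
    LinearIndependent K fun p : κ × Fin s => e p.1 p.2 := by
  induction s with
  | zero => exact linearIndependent_empty_type
  | succ n ih =>
    rw [Fintype.linearIndependent_iff]
    intro a ha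
    rw [Fintype.sum_prod_type] at ha
    simp only [Fin.sum_univ_succ, Finset.sum_add_distrib] at ha
    have hN0 (c : κ) : N (e c 0) = 0 := by rw [h]; rfl
    have hNs (c : κ) (j : Fin n) : N (e c j.succ) = e c j.castSucc := by rw [h]; rfl
    have h1 := congrArg N ha
    simp only [map_add, map_sum, map_smul, hN0, hNs, smul_zero, Finset.sum_const_zero, zero_add,
      map_zero] at h1
    have hli := ih (e := fun c j => e c j.castSucc) (fun c j => (h c _).trans rfl) fun hs => h0 _
    rw [Fintype.linearIndependent_iff] at hli
    have h2 := hli (fun p => a (p.1, p.2.succ)) (by rw [Fintype.sum_prod_type]; exact h1)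
    have h3 (c : κ) (j : Fin n) : a (c, j.succ) = 0 := h2 (c, j)
    simp only [h3, zero_smul, Finset.sum_const_zero, add_zero] at ha
    have h4 := Fintype.linearIndependent_iff.1 (h0 n.succ_pos) (fun c => a (c, 0)) ha
    rintro ⟨c, j⟩
    refine Fin.cases (h4 c) (h3 c) j

theorem isRealJordanSubspace_top_of_cyclic_of_dvd_X_pow {T : Module.End ℝ V} {w : V}
    (hw : cyclicSubspace T w = ⊤) {n : ℕ} (hn : 0 < n)
    (hann : ∀ q : ℝ[X], aeval T q w = 0 ↔ X ^ n ∣ q) : IsRealJordanSubspace T 0 n ⊤ := by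
  have hne : (T ^ (n - 1)) w ≠ 0 := by
    have := (hann (X ^ (n - 1))).not.2 (by
      rw [pow_dvd_pow_iff X_ne_zero not_isUnit_X]; omega)
    simpa using this
  have hz : (T ^ n) w = 0 := by simpa using (hann (X ^ n)).2 dvd_rfl
  have hT : ∀ j : Fin n, T ((T ^ (n - 1 - j.val)) w) =
      chainPred (fun j : Fin n => (T ^ (n - 1 - j.val)) w) j := by
    intro j
    rw [← Module.End.mul_apply, ← pow_succ', chainPred]
    have := j.isLt
    split_ifs with h
    · rw [h, Nat.sub_zero, Nat.sub_add_cancel hn, hz]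
    · congr 2
      simp only
      omega
  refine Or.inl ⟨rfl, fun j => (T ^ (n - 1 - j.val)) w,
    linearIndependent_of_chain hT fun hs => by simpa using hne, ?_, hT⟩
  rw [eq_top_iff, ← hw]
  rintro _ ⟨q, rfl⟩
  change aeval T q w ∈ _
  rw [aeval_eq_sum_range, LinearMap.sum_apply]
  refine Submodule.sum_mem _ fun k _ => Submodule.smul_mem _ _ ?_
  by_cases hk : k < n
  · refine Submodule.subset_span ⟨⟨n - 1 - k, by omega⟩, ?_⟩
    change (T ^ (n - 1 - (n - 1 - k))) w = _
    rw [Nat.sub_sub_self (by omega)]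
  · rw [← Nat.sub_add_cancel (not_lt.1 hk), pow_add, Module.End.mul_apply, hz, map_zero]
    exact Submodule.zero_mem _

/-- Take the Jordan-Chevalley parts `S` and `N` of `T`. Then `S² = -ω²` and `r(T) = (2S + N)N` with
`2S + N` injective, so `N` inherits the exact nilpotency order `n` on `w`. The chain `N ^ k w` and
its images under `ω⁻¹ S` form the block. -/
theorem isRealJordanSubspace_top_of_cyclic [FiniteDimensional ℝ V] {T : Module.End ℝ V} {w : V}
    (hw : cyclicSubspace T w = ⊤) {n : ℕ} (hn : 0 < n) {ω : ℝ} (hω : ω ≠ 0)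
    (hann : ∀ q : ℝ[X], aeval T q w = 0 ↔ (X ^ 2 + C (ω ^ 2)) ^ n ∣ q) :
    IsRealJordanSubspace T ω n ⊤ := by
  set r : ℝ[X] := X ^ 2 + C (ω ^ 2) with hr
  have hrdeg : r.natDegree = 2 := natDegree_X_pow_add_C
  have hr0 : r ≠ 0 := fun h => by simp [h] at hrdeg
  have hru : ¬ IsUnit r := fun h => by
    rw [natDegree_eq_zero_of_isUnit h] at hrdeg
    omega
  have hrE (E : Module.End ℝ V) (x : V) : aeval E r x = E (E x) + ω ^ 2 • x := by
    simp [hr, pow_two, mul_smul]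
  obtain ⟨N, hN, S, hS, hNn, hSs, hTS⟩ := T.exists_isNilpotent_isSemisimple
  have hcSN : Commute S N := by
    have h1 : Commute T S := Algebra.commute_of_mem_adjoin_self (R := ℝ) hS
    have h2 : N = T - S := by rw [hTS, add_sub_cancel_right]
    rw [h2]
    exact h1.symm.sub_right (Commute.refl S)
  have hT (x : V) : T x = S x + N x := by rw [hTS, add_comm]; rfl
  have hTN : Commute T N := by
    rw [hTS]
    exact (Commute.refl N).add_left hcSN
  have hTr : aeval T r ^ n = 0 := by
    ext x
    obtain ⟨q, rfl⟩ : x ∈ cyclicSubspace T w := hw ▸ Submodule.mem_top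
    change (aeval T r ^ n) (aeval T q w) = 0
    rw [← map_pow, ← Module.End.mul_apply, ← map_mul, hann]
    exact dvd_mul_right _ _
  -- `r(S)` differs from the nilpotent `r(T)` by a commuting nilpotent, so it is nilpotent; it is
  -- also semisimple, hence zero.
  have hSr : aeval S r = 0 := by
    refine Module.End.eq_zero_of_isNilpotent_isSemisimple ?_ (hSs.aeval r)
    have h1 : aeval S r = aeval T r - N * ((2 : ℝ) • S + N) := by
      ext x
      have hc (y : V) : S (N y) = N (S y) := LinearMap.congr_fun hcSN.eq y
      rw [LinearMap.sub_apply, hrE, hrE, hT, hT]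
      simp only [map_add, Module.End.mul_apply, LinearMap.add_apply, hc, two_smul]
      abel
    rw [h1]
    have h2 : Commute N ((2 : ℝ) • S + N) :=
      (hcSN.symm.smul_right 2).add_right (Commute.refl N)
    have hmem : aeval T r ∈ Algebra.adjoin ℝ {T} := aeval_mem_adjoin_singleton ℝ T
    have h3 : Commute (aeval T r) N :=
      (Algebra.commute_of_mem_adjoin_singleton_of_commute hmem hTN.symm).symm
    have hTS' : Commute T S := Algebra.commute_of_mem_adjoin_self (R := ℝ) hS
    have h4 : Commute (aeval T r) ((2 : ℝ) • S + N) :=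
      ((Algebra.commute_of_mem_adjoin_singleton_of_commute hmem hTS'.symm).symm.smul_right
        2).add_right h3
    exact (h3.mul_right h4).isNilpotent_sub ⟨n, hTr⟩ (h2.isNilpotent_mul_right hNn)
  have hSS (x : V) : S (S x) = -(ω ^ 2 • x) := by
    have h1 := LinearMap.congr_fun hSr x
    rw [hrE] at h1
    exact eq_neg_of_add_eq_zero_left h1
  set M : Module.End ℝ V := (2 : ℝ) • S + N
  have hMN : Commute M N := (hcSN.smul_left 2).add_left (Commute.refl N)
  have hTM : aeval T r = M * N := by
    ext x
    have hc (y : V) : S (N y) = N (S y) := LinearMap.congr_fun hcSN.eq y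
    rw [hrE, hT, hT, map_add, map_add, hSS, Module.End.mul_apply]
    simp only [M, LinearMap.add_apply, hc, two_smul]
    abel
  obtain ⟨m, hm⟩ := hNn
  have hMinj (x : V) (hx : M x = 0) : x = 0 := by
    refine eq_zero_of_eq_pow_apply (M := (2 * ω ^ 2)⁻¹ • S) (N := N) (hcSN.smul_left _)
      (n := m) (by rw [hm]; rfl) ?_
    have h2 := congrArg S hx
    simp only [M, LinearMap.add_apply, LinearMap.smul_apply, map_add, map_smul, hSS,
      map_zero] at h2
    have h3 : S (N x) = (2 * ω ^ 2) • x := by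
      rw [← sub_eq_zero, ← h2, mul_smul, smul_neg]
      abel
    rw [LinearMap.smul_apply, h3, inv_smul_smul₀]
    positivity
  have hMinj' (k : ℕ) (x : V) (hx : (M ^ k) x = 0) : x = 0 := by
    induction k with
    | zero => exact hx
    | succ k ih =>
      rw [pow_succ', Module.End.mul_apply] at hx
      exact ih (hMinj _ hx)
  have hNn : (N ^ n) w = 0 := by
    refine hMinj' n _ ?_
    rw [← Module.End.mul_apply, ← hMN.mul_pow, ← hTM, hTr]
    rfl
  have hNn' : (N ^ (n - 1)) w ≠ 0 := by
    intro h0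
    have h1 : aeval T (r ^ (n - 1)) w ≠ 0 := (hann _).not.2 (by
      rw [pow_dvd_pow_iff hr0 hru]; omega)
    apply h1
    rw [map_pow, hTM, hMN.mul_pow, Module.End.mul_apply, h0, map_zero]
  let u : Fin n → V := fun j => (N ^ (n - 1 - j.val)) w
  let v : Fin n → V := fun j => ω⁻¹ • S (u j)
  have hNu (j : Fin n) : N (u j) = chainPred u j := by
    change N ((N ^ (n - 1 - j.val)) w) = _
    rw [← Module.End.mul_apply, ← pow_succ', chainPred]
    have := j.isLt
    split_ifs with h
    · rw [h, Nat.sub_zero, Nat.sub_add_cancel hn, hNn]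
    · simp only [u]
      congr 2
      omega
  have hNv (j : Fin n) : N (v j) = chainPred v j := by
    have hc : N (S (u j)) = S (N (u j)) := (LinearMap.congr_fun hcSN.eq (u j)).symm
    simp only [v]
    rw [map_smul, hc, hNu]
    unfold chainPred
    split_ifs
    · rw [map_zero, smul_zero]
    · rfl
  have hSu (j : Fin n) : S (u j) = ω • v j := (smul_inv_smul₀ hω _).symm
  have hSv (j : Fin n) : S (v j) = -(ω • u j) := by
    simp only [v]
    rw [map_smul, hSS, smul_neg, smul_smul, pow_two, inv_mul_cancel_left₀ hω]
  have hTu (j : Fin n) : T (u j) = ω • v j + chainPred u j := by rw [hT, hSu, hNu]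
  have hTv (j : Fin n) : T (v j) = -(ω • u j) + chainPred v j := by rw [hT, hSv, hNv]
  refine Or.inr ⟨hω, u, v, ?_, ?_, fun j => ⟨hTu j, hTv j⟩⟩
  · let e : Bool → Fin n → V := fun b => bif b then v else u
    have he : LinearIndependent ℝ fun p : Bool × Fin n => e p.1 p.2 := by
      refine linearIndependent_of_chains (N := N) ?_ fun hs => ?_
      · rintro (_ | _)
        · exact hNu
        · exact hNv
      · have hu0 : u ⟨0, hs⟩ ≠ 0 := hNn'
        rw [Fintype.linearIndependent_iff]
        intro a ha
        rw [Fintype.sum_bool] at ha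
        change a true • v ⟨0, hs⟩ + a false • u ⟨0, hs⟩ = 0 at ha
        have h1 := congrArg S ha
        rw [map_add, map_smul S (a true), map_smul S (a false), hSv, hSu, map_zero] at h1
        -- Combining the relation with its image under `S` eliminates `v` and leaves a sum of
        -- squares.
        have h2 : (ω * (a true ^ 2 + a false ^ 2)) • u ⟨0, hs⟩ = 0 := by
          have : (ω * (a true ^ 2 + a false ^ 2)) • u ⟨0, hs⟩ =
              (ω * a false) • (a true • v ⟨0, hs⟩ + a false • u ⟨0, hs⟩) -
              a true • (a true • -(ω • u ⟨0, hs⟩) + a false • ω • v ⟨0, hs⟩) := by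
            module
          rw [this, ha, h1, smul_zero, smul_zero, sub_zero]
        have h3 : a true ^ 2 + a false ^ 2 = 0 := by
          simpa [hu0, hω] using h2
        rintro (_ | _)
        · nlinarith [sq_nonneg (a true), sq_nonneg (a false)]
        · nlinarith [sq_nonneg (a true), sq_nonneg (a false)]
    have := he.comp _ (Equiv.injective (Equiv.boolProdEquivSum (Fin n)).symm)
    convert this using 1
    funext x
    rcases x with j | j <;> rfl
  · have huS (j : Fin n) : u j ∈ Submodule.span ℝ (Set.range (Sum.elim u v)) :=
      Submodule.subset_span ⟨Sum.inl j, rfl⟩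
    have hvS (j : Fin n) : v j ∈ Submodule.span ℝ (Set.range (Sum.elim u v)) :=
      Submodule.subset_span ⟨Sum.inr j, rfl⟩
    have hinv : Submodule.span ℝ (Set.range (Sum.elim u v)) ≤
        (Submodule.span ℝ (Set.range (Sum.elim u v))).comap T := by
      have hpu (j : Fin n) : chainPred u j ∈ Submodule.span ℝ (Set.range (Sum.elim u v)) := by
        unfold chainPred
        split_ifs
        · exact Submodule.zero_mem _
        · exact huS _
      have hpv (j : Fin n) : chainPred v j ∈ Submodule.span ℝ (Set.range (Sum.elim u v)) := by
        unfold chainPred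
        split_ifs
        · exact Submodule.zero_mem _
        · exact hvS _
      rw [Submodule.span_le]
      rintro _ ⟨j | j, rfl⟩
      · change T (u j) ∈ Submodule.span ℝ (Set.range (Sum.elim u v))
        rw [hTu]
        exact add_mem (Submodule.smul_mem _ _ (hvS j)) (hpu j)
      · change T (v j) ∈ Submodule.span ℝ (Set.range (Sum.elim u v))
        rw [hTv]
        exact add_mem (neg_mem (Submodule.smul_mem _ _ (huS j))) (hpv j)
    rw [eq_top_iff, ← hw]
    rintro _ ⟨q, rfl⟩
    change aeval T q w ∈ _
    rw [aeval_eq_sum_range, LinearMap.sum_apply]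
    refine Submodule.sum_mem _ fun k hk => Submodule.smul_mem _ _ ?_
    clear hk
    induction k with
    | zero =>
      have := huS ⟨n - 1, by omega⟩
      simpa [u] using this
    | succ k ih =>
      rw [pow_succ', Module.End.mul_apply]
      exact hinv ih

theorem IsRealJordanSubspace.of_restrict {A : Module.End ℝ V} {W : Submodule ℝ V}
    (hW : ∀ x ∈ W, A x ∈ W) {ω : ℝ} {s : ℕ} (h : IsRealJordanSubspace (A.restrict hW) ω s ⊤) :
    IsRealJordanSubspace A ω s W := by
  have hspan {ι : Type} (e : ι → W) (he : Submodule.span ℝ (Set.range e) = ⊤) :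
      Submodule.span ℝ (Set.range (W.subtype ∘ e)) = W := by
    rw [Set.range_comp, ← Submodule.map_span, he, Submodule.map_top, Submodule.range_subtype]
  rcases h with ⟨hω, e, he, hs, hA⟩ | ⟨hω, u, v, he, hs, hA⟩
  · refine Or.inl ⟨hω, W.subtype ∘ e, he.map' _ W.ker_subtype, hspan e hs, fun j => ?_⟩
    rw [← map_chainPred W.subtype, ← hA]
    rfl
  · have hsum : Sum.elim (W.subtype ∘ u) (W.subtype ∘ v) = W.subtype ∘ Sum.elim u v :=
      (Sum.comp_elim _ _ _).symm
    refine Or.inr ⟨hω, W.subtype ∘ u, W.subtype ∘ v, ?_, ?_, fun j => ⟨?_, ?_⟩⟩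
    · rw [hsum]
      exact he.map' _ W.ker_subtype
    · rw [hsum]
      exact hspan _ hs
    · rw [← map_chainPred W.subtype]
      exact congrArg Subtype.val (hA j).1
    · rw [← map_chainPred W.subtype]
      exact congrArg Subtype.val (hA j).2

/-- An irreducible real polynomial that annihilates a nonzero vector is, up to a unit, `X` or
`X ^ 2 + ω ^ 2` if all eigenvalues are imaginary. -/
theorem associated_of_irreducible_of_aeval_apply_eq_zero [FiniteDimensional ℝ V]
    {A : Module.End ℝ V} (hA : EigenvaluesImaginary A) {p : ℝ[X]} (hp : Irreducible p) {x : V}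
    (hx : x ≠ 0) (hpx : aeval A p x = 0) :
    Associated p X ∨ ∃ ω : ℝ, 0 < ω ∧ Associated p (X ^ 2 + C (ω ^ 2)) := by
  have hne : (1 : ℂ) ⊗ₜ[ℝ] x ≠ 0 := fun h => hx (tmul_add_tmul_eq_zero_iff (b := (0 : V)).1 (by
    rw [TensorProduct.tmul_zero, add_zero, h])).1
  have hnt : Nontrivial (ℂ ⊗[ℝ] V) := ⟨_, _, hne⟩
  have hap (q : ℝ[X]) (y : V) : aeval (complexify A) (q.map (algebraMap ℝ ℂ)) ((1 : ℂ) ⊗ₜ[ℝ] y) =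
      (1 : ℂ) ⊗ₜ[ℝ] (aeval A q y) := by
    induction q using Polynomial.induction_on generalizing y with
    | C a =>
      rw [Polynomial.map_C, aeval_C, aeval_C, Module.algebraMap_end_apply,
        Module.algebraMap_end_apply, one_tmul_smul]
      rfl
    | add q r hq hr =>
      rw [Polynomial.map_add, map_add, map_add, LinearMap.add_apply, LinearMap.add_apply, hq, hr,
        TensorProduct.tmul_add]
    | monomial k a ih =>
      rw [pow_succ, ← mul_assoc, Polynomial.map_mul, map_mul, map_mul, Module.End.mul_apply,
        Module.End.mul_apply, Polynomial.map_X, aeval_X, aeval_X, complexify_tmul, ih]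
  have hspec : (0 : ℂ) ∈ spectrum ℂ (aeval (complexify A) (p.map (algebraMap ℝ ℂ))) := by
    rw [← Module.End.hasEigenvalue_iff_mem_spectrum]
    refine Module.End.hasEigenvalue_of_hasEigenvector (x := (1 : ℂ) ⊗ₜ[ℝ] x)
      ⟨Module.End.mem_eigenspace_iff.2 ?_, hne⟩
    rw [hap, hpx, TensorProduct.tmul_zero, zero_smul]
  have hdeg : 0 < (p.map (algebraMap ℝ ℂ)).degree := by
    rw [degree_map]
    exact hp.degree_pos
  rw [spectrum.map_polynomial_aeval_of_degree_pos _ _ hdeg] at hspec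
  obtain ⟨z, hz, hpz⟩ := hspec
  rw [← Module.End.hasEigenvalue_iff_mem_spectrum] at hz
  have hre := hA z hz
  have hpz' : aeval z p = 0 := by
    rw [← eval_map_algebraMap]
    exact hpz
  -- By spectral mapping `p` has a root `z` among the eigenvalues, so `p` is associated to the
  -- minimal polynomial of `z`.
  have hdvd : ∀ q : ℝ[X], aeval z q = 0 → p ∣ q := fun q hq => by
    have h1 := minpoly.dvd ℝ z hpz'
    have hint : IsIntegral ℝ z := Algebra.IsIntegral.isIntegral z
    exact (((minpoly.irreducible hint).associated_of_dvd hp h1).symm.dvd).trans (minpoly.dvd ℝ z hq)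
  by_cases him : z.im = 0
  · left
    refine hp.associated_of_dvd irreducible_X (hdvd X ?_)
    rw [aeval_X]
    exact Complex.ext hre him
  · right
    have hz2 : z ^ 2 = -((|z.im| : ℝ) : ℂ) ^ 2 := by
      have hzI : z = Complex.I * z.im := by apply Complex.ext <;> simp [hre]
      rw [← Complex.ofReal_pow, sq_abs, Complex.ofReal_pow]
      calc z ^ 2 = (Complex.I * z.im) ^ 2 := by rw [← hzI]
        _ = _ := by rw [mul_pow, Complex.I_sq]; ring
    refine ⟨|z.im|, abs_pos.2 him, hp.associated_of_dvd ?_ (hdvd _ ?_)⟩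
    · have hd : (X ^ 2 + C (|z.im| ^ 2) : ℝ[X]).natDegree = 2 := natDegree_X_pow_add_C
      rw [irreducible_iff_roots_eq_zero_of_degree_le_three (by omega) (by omega)]
      refine Multiset.eq_zero_of_forall_notMem fun a ha => ?_
      have h1 := (mem_roots'.1 ha).2
      simp only [IsRoot.def, eval_add, eval_pow, eval_X, eval_C] at h1
      have : 0 < |z.im| := abs_pos.2 him
      nlinarith [sq_nonneg a, pow_pos this 2]
    · rw [map_add, map_pow, aeval_X, aeval_C, hz2, Complex.coe_algebraMap, Complex.ofReal_pow,
        neg_add_cancel]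

theorem exists_isRealJordanSubspace_cyclicSubspace [FiniteDimensional ℝ V] {A : Module.End ℝ V}
    (hA : EigenvaluesImaginary A) {p : ℝ[X]} (hp : Irreducible p) {n : ℕ} (hn : 0 < n) {w : V}
    (hw : ∀ q : ℝ[X], aeval A q w = 0 ↔ p ^ n ∣ q) :
    ∃ ω : ℝ, 0 ≤ ω ∧ IsRealJordanSubspace A ω n (cyclicSubspace A w) := by
  have hinv : ∀ x ∈ cyclicSubspace A w, A x ∈ cyclicSubspace A w := by
    rintro _ ⟨q, rfl⟩
    refine mem_cyclicSubspace.2 ⟨X * q, ?_⟩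
    rw [map_mul, aeval_X]
    rfl
  have hwm : w ∈ cyclicSubspace A w := mem_cyclicSubspace.2 ⟨1, by simp⟩
  have haev (q : ℝ[X]) (x : cyclicSubspace A w) :
      ((aeval (A.restrict hinv) q x : cyclicSubspace A w) : V) = aeval A q (x : V) := by
    induction q using Polynomial.induction_on generalizing x with
    | C a => simp [Algebra.algebraMap_eq_smul_one]
    | add q r hq hr => simp [hq, hr]
    | monomial k a ih =>
      have hX {M : Type _} [AddCommGroup M] [Module ℝ M] (T : Module.End ℝ M) (y : M) :
          aeval T (C a * X ^ (k + 1)) y = aeval T (C a * X ^ k) (T y) := by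
        rw [pow_succ, ← mul_assoc, map_mul, aeval_X]
        rfl
      rw [hX, hX, ih]
      rfl
  have htop : cyclicSubspace (A.restrict hinv) ⟨w, hwm⟩ = ⊤ := by
    rw [eq_top_iff]
    rintro ⟨x, hx⟩ -
    obtain ⟨q, hq⟩ := mem_cyclicSubspace.1 hx
    exact mem_cyclicSubspace.2 ⟨q, Subtype.ext ((haev q _).trans hq)⟩
  have hann (q : ℝ[X]) : aeval (A.restrict hinv) q (⟨w, hwm⟩ : cyclicSubspace A w) = 0 ↔
      p ^ n ∣ q := by
    rw [← hw, ← haev q ⟨w, hwm⟩, ZeroMemClass.coe_eq_zero]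
  -- This nonzero vector is killed by `p(A)`, which determines the type of `p`.
  have hx : aeval A (p ^ (n - 1)) w ≠ 0 := (hw _).not.2 (by
    rw [pow_dvd_pow_iff hp.ne_zero hp.not_isUnit]; omega)
  have hpx : aeval A p (aeval A (p ^ (n - 1)) w) = 0 := by
    rw [← Module.End.mul_apply, ← map_mul, ← pow_succ', Nat.sub_add_cancel hn, hw]
  rcases associated_of_irreducible_of_aeval_apply_eq_zero hA hp hx hpx with h | ⟨ω, hω, h⟩
  · refine ⟨0, le_rfl, IsRealJordanSubspace.of_restrict hinv
      (isRealJordanSubspace_top_of_cyclic_of_dvd_X_pow htop hn fun q => ?_)⟩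
    rw [hann, (h.pow_pow).dvd_iff_dvd_left]
  · refine ⟨ω, hω.le, IsRealJordanSubspace.of_restrict hinv
      (isRealJordanSubspace_top_of_cyclic htop hn hω.ne' fun q => ?_)⟩
    rw [hann, (h.pow_pow).dvd_iff_dvd_left]

theorem nonempty_realJordanDecomposition [FiniteDimensional ℝ V] {A : Module.End ℝ V}
    (hA : EigenvaluesImaginary A) : Nonempty (RealJordanDecomposition A) := by
  classical
  obtain ⟨ι, _, p, n, w, hp, hw, hind, htop⟩ := exists_cyclic_decomposition A
  -- Summands with exponent `0` are zero and are dropped, as blocks must have positive size.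
  let κ := {i : ι // n i ≠ 0}
  have hJ : ∀ i : κ, ∃ ω : ℝ, 0 ≤ ω ∧ IsRealJordanSubspace A ω (n i) (cyclicSubspace A (w i)) :=
    fun i => exists_isRealJordanSubspace_cyclicSubspace hA (hp i) (Nat.pos_of_ne_zero i.2) (hw i)
  choose ω hω hJ using hJ
  let f : Fin (Fintype.card κ) ≃ κ := (Fintype.equivFin κ).symm
  refine ⟨⟨Fintype.card κ, fun k => n (f k), fun k => Nat.pos_of_ne_zero (f k).2,
    fun k => ω (f k), fun k => hω _, fun k => cyclicSubspace A (w (f k)), fun k => hJ _, ?_⟩⟩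
  rw [DirectSum.isInternal_submodule_iff_iSupIndep_and_iSup_eq_top]
  refine ⟨hind.comp (f := fun k => (f k : ι)) (Subtype.val_injective.comp f.injective), ?_⟩
  rw [f.iSup_comp (g := fun k : κ => cyclicSubspace A (w k)), eq_top_iff, ← htop]
  refine iSup_le fun i => ?_
  by_cases hi : n i = 0
  · rintro _ ⟨q, rfl⟩
    have : aeval A q (w i) = 0 := (hw i q).2 (by simp [hi])
    change aeval A q (w i) ∈ _
    rw [this]
    exact Submodule.zero_mem _
  · exact le_iSup (fun k : κ => cyclicSubspace A (w k)) ⟨i, hi⟩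

end Existence

/-! ### Conjugacy invariance of the Jordan data -/

/-- Conjugate projective flows have the same numbers `d s`, for all real Jordan decompositions. -/
theorem d_eq_of_topConjugate {V : Type*} [NormedAddCommGroup V] [NormedSpace ℝ V]
    [FiniteDimensional ℝ V] {A B : Module.End ℝ V}
    (h : TopConjugate (projFlow A) (projFlow B)) (D : RealJordanDecomposition A)
    (D' : RealJordanDecomposition B) {s : ℕ} (hs : 0 < s) : D.d s = D'.d s := by
  obtain ⟨S, N, hD⟩ := D.exists_isSplit
  obtain ⟨S', N', hD'⟩ := D'.exists_isSplit
  obtain ⟨s, rfl⟩ := Nat.exists_eq_add_of_lt hs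
  have h1 := hD.finrank_chainEnds s
  have h2 := hD'.finrank_chainEnds s
  have h3 := finrank_chainEnds_eq hD.isBoundedNilpotentSplit hD'.isBoundedNilpotentSplit h
  rw [h3, h3] at h1
  rw [zero_add]
  omega

theorem sMax_eq_of_topConjugate {V : Type*} [NormedAddCommGroup V] [NormedSpace ℝ V]
    [FiniteDimensional ℝ V] {A B : Module.End ℝ V} (hA : EigenvaluesImaginary A)
    (hB : EigenvaluesImaginary B) (h : TopConjugate (projFlow A) (projFlow B)) :
    sMax A = sMax B := by
  obtain ⟨D⟩ := nonempty_realJordanDecomposition hA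
  obtain ⟨D'⟩ := nonempty_realJordanDecomposition hB
  obtain ⟨S, N, hD⟩ := D.exists_isSplit
  obtain ⟨S', N', hD'⟩ := D'.exists_isSplit
  have h3 := finrank_chainEnds_eq hD.isBoundedNilpotentSplit hD'.isBoundedNilpotentSplit h
  unfold sMax
  congr 1
  ext s
  rcases s with _ | s
  -- The empty basis makes `0` a size for both operators.
  · exact iff_of_true
      ⟨0, _, Fin.elim0, linearIndependent_empty_type, rfl, fun j => j.elim0⟩
      ⟨0, _, Fin.elim0, linearIndependent_empty_type, rfl, fun j => j.elim0⟩
  · refine (hD.exists_isComplexJordanSubspace_iff hA s).trans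
      (Iff.trans ?_ (hD'.exists_isComplexJordanSubspace_iff hB s).symm)
    rw [← Submodule.one_le_finrank_iff, ← Submodule.one_le_finrank_iff, h3]

theorem topConjugate_refl {X : Type*} [TopologicalSpace X] (φ : Flow ℝ X) : TopConjugate φ φ :=
  ⟨Homeomorph.refl X, fun _ _ => rfl⟩

end ProjFlow

theorem corollary3 {V : Type*} [NormedAddCommGroup V] [NormedSpace ℝ V] [FiniteDimensional ℝ V]
    (A B : Module.End ℝ V)
    (hA : ProjFlow.EigenvaluesImaginary A) (hB : ProjFlow.EigenvaluesImaginary B)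
    (hconj : ProjFlow.TopConjugate (ProjFlow.projFlow A) (ProjFlow.projFlow B)) :
    ProjFlow.sMax A = ProjFlow.sMax B ∧
      ∀ s ∈ Finset.Icc 1 (ProjFlow.sMax A),
        ∃ d : ℕ, ProjFlow.HasJordanDim A s d ∧ ProjFlow.HasJordanDim B s d := by
  refine ⟨ProjFlow.sMax_eq_of_topConjugate hA hB hconj, fun s hs => ?_⟩
  have hs : 0 < s := (Finset.mem_Icc.1 hs).1
  obtain ⟨D⟩ := ProjFlow.nonempty_realJordanDecomposition hA
  obtain ⟨D'⟩ := ProjFlow.nonempty_realJordanDecomposition hB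
  -- Conjugacy of the flow of `A` with itself gives independence of the chosen decomposition.
  exact ⟨D.d s,
    ⟨⟨D⟩, fun E => ProjFlow.d_eq_of_topConjugate (ProjFlow.topConjugate_refl _) E D hs⟩,
    ⟨⟨D'⟩, fun E => (ProjFlow.d_eq_of_topConjugate hconj D E hs).symm⟩⟩
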